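/- **Setting.** For $r\in[1,\infty]$ let $\|\cdot\|_r$ be the $\ell_r$ norm on $\mathbb R^d$ and let $\mathcal B^p_\epsilon(x)=\{x':\|x'-x\|_p\le\epsilon\}$. Fix $\mu\in\mathbb R^d$. The clean distribution $\tilde{\mathcal D}$ on $\mathbb R^d\times\{\pm1\}$ is the law of $(\tilde x,\tilde y)$, where $\tilde y$ is uniform on $\{\pm1\}$ and $\tilde x=\tilde y\mu+\xi$, with $\xi$ independent of $\tilde y$ and $\xi_1,\dots,\xi_d$ i.i.d., of mean zero and with sub-Gaussian norm $\sup_{r\ge1}r^{-1/2}(\mathbb E|\xi_j|^r)^{1/r}\le1$. The noisy distribution $\mathcal D$ is any distribution on $\mathbb R^d\times\{\pm1\}$ that has the same marginal on $\mathbb R^d$ as $\tilde{\mathcal D}$ and satisfies $d_{\mathrm{TV}}(\mathcal D,\tilde{\mathcal D})\le\eta$, where $d_{\mathrm{TV}}(P,Q)=\sup_A|P(A)-Q(A)|$. The training sample $(x_i,y_i)_{i=1}^n$ is i.i.d. from $\mathcal D$. Let $1\le p<\infty$, $1/p+1/q=1$, $\epsilon\ge0$, and $$L(\theta)=\sum_{i=1}^n\max_{x'\in\mathcal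 B^p_\epsilon(x_i)}\exp(-y_i\theta^\top x'),\quad \bar\gamma=\max_{\|\theta\|_q=1}\min_i y_i\theta^\top x_i,\quad \gamma=\max_{\|\theta\|_2=1}\min_i\min_{x'\in\mathcal B^p_\epsilon(x_i)}y_i\theta^\top x'.$$ Adversarial training is the iteration $\theta_0=0$, $\theta_{t+1}=\theta_t-\alpha_t\nabla L(\theta_t)$, where $\nabla L$ may be any subgradient at points where $L$ is not differentiable. The classifier is $f_\theta(x)=\operatorname{sign}(\theta^\top x)$, with $\operatorname{sign}(0)=0$ (so a tie counts as an error). **Theorem (Adversarial Risk of Adversarial Training).** There are absolute constants $C',C'',C'''>0$ and $T$ such that for all $\kappa\in(0,1]$ and $R>0$ there are constants $C,G_0>0$, depending only on $\kappa$ and $R$, for which the following holds for every $G\ge G_0$, $p\in[1,\infty)$ and $\delta\in(0,1)$. Suppose that $\mathbb E\|\xi\|_2^2\ge\kappa d$, $\epsilon\le R$, $n\ge C\log(1/\delta)$, $d\ge C\max\{n\|\mu\|_2^2,\,n^2\log(n/\delta)\}$, $\eta<1/C$ and $\|\mu\|_2^2\ge C\max\{\log(n/\delta),\,\epsilon\|\mu\|_q\}$.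 Then there is an event of probability at least $1-\delta$ over the training sample on which the following holds. If $\epsilon<\bar\gamma$ and the step sizes are $\alpha_0=1/(Gdn)$ and $\alpha_t=\alpha$ for $t\ge1$, where $0<\alpha\le1/(GdnM)$ and $$M=\max\Big\{\Big[2d+\epsilon(q-1)d^{\frac{3q-2}{2q-2}}/\gamma\Big]\exp\big(-\gamma^2/(Gd)+\epsilon/G\big),\,1\Big\}$$ (for $q=\infty$ the term with the factor $q-1$ is omitted), then for all $t\ge T$: * if $1\le p\le2$ and $B_t:=\dfrac{\|\mu\|_2^2-4\epsilon\|\mu\|_q}{(C''+\epsilon)\sqrt d}-\dfrac{C'''\|\mu\|_2\log n}{\log t}-\epsilon\ge0$, then $$\mathbb P_{(x,y)\sim\mathcal D}\big[\exists x'\in\mathcal B^p_\epsilon(x):\ f_{\theta_t}(x')\ne y\big]\le\eta+\exp(-C'B_t^2);$$ * if $p>2$, the same bound holds with $B_t:=\dfrac{\|\mu\|_2^2-4\epsilon\|\mu\|_q}{(C''+\epsilon)\sqrt d}-\dfrac{C'''\|\mu\|_2\log n}{\log t}-\epsilon d^{\frac1q-\frac12}$, provided that $B_t\ge0$. -/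

import Mathlib

open MeasureTheory
open scoped ENNReal NNReal

noncomputable section

namespace AdvTraining

/-- The `ℓ_r` norm on `ℝ^d`, for `r ∈ [1, ∞]`. -/
def vecNorm {d : ℕ} (r : ℝ≥0∞) (v : Fin d → ℝ) : ℝ := ‖WithLp.toLp r v‖

/-- The closed `ℓ_p` ball of radius `ε` around `x`. -/
def pBall {d : ℕ} (p : ℝ≥0∞) (ε : ℝ) (x : Fin d → ℝ) : Set (Fin d → ℝ) :=
  {x' | vecNorm p (x' - x) ≤ ε}

/-- A labelled point; the label set `{1, -1}` is the group of units of `ℤ`. -/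
abbrev Pt (d : ℕ) : Type := (Fin d → ℝ) × ℤˣ

/-- A label as a real number. -/
def lab (y : ℤˣ) : ℝ := ((y : ℤ) : ℝ)

/-- The sub-Gaussian norm `sup_{r ≥ 1} r^{-1/2} (E|X|^r)^{1/r}` of a real random variable
with law `ν`. -/
def subGaussianNorm (ν : Measure ℝ) : ℝ≥0∞ :=
  ⨆ r : {r : ℝ // 1 ≤ r},
    ENNReal.ofReal ((r : ℝ) ^ (-(1 / 2) : ℝ)) * eLpNorm (fun x : ℝ => x) (ENNReal.ofReal r) ν

/-- The law of the noise vector: `d` i.i.d. coordinates with law `ν`. -/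
def noiseLaw (d : ℕ) (ν : Measure ℝ) : Measure (Fin d → ℝ) := Measure.pi fun _ => ν

/-- The clean distribution: `ỹ` uniform on `{1, -1}`, `x̃ = ỹ μ + ξ`, with `ξ` independent
of `ỹ`. -/
def cleanLaw {d : ℕ} (ν : Measure ℝ) (μ : Fin d → ℝ) : Measure (Pt d) :=
  ((PMF.uniformOfFintype ℤˣ).toMeasure.prod (noiseLaw d ν)).map
    fun w => (lab w.1 • μ + w.2, w.1)

/-- Total variation distance of two probability measures. -/
def tvDist {Ω : Type*} [MeasurableSpace Ω] (P Q : Measure Ω) : ℝ :=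
  ⨆ A : {A : Set Ω // MeasurableSet A}, |P.real A - Q.real A|

/-- `D` is a noisy version, of noise level at most `η`, of the clean distribution `D'`. -/
def IsNoisyVersion {d : ℕ} (D D' : Measure (Pt d)) (η : ℝ) : Prop :=
  D.map Prod.fst = D'.map Prod.fst ∧ tvDist D D' ≤ η

/-- The adversarial training loss `∑ i, max_{x' ∈ B(x_i)} exp (- y_i θᵀ x')`. -/
def advLoss {d n : ℕ} (p : ℝ≥0∞) (ε : ℝ) (S : Fin n → Pt d) (θ : Fin d → ℝ) : ℝ :=
  ∑ i, sSup ((fun x' => Real.exp (-(lab (S i).2 * (θ ⬝ᵥ x')))) '' pBall p ε (S i).1)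

/-- `g` is a subgradient of `F` at `θ`; for convex `F` it is the gradient wherever `F` is
differentiable. -/
def IsSubgradient {d : ℕ} (F : (Fin d → ℝ) → ℝ) (θ g : Fin d → ℝ) : Prop :=
  ∀ θ', F θ + g ⬝ᵥ (θ' - θ) ≤ F θ'

/-- `θ` is a run of gradient descent adversarial training, with step sizes `α`, from `0`. The
loss is not differentiable at `0` when `ε > 0`; any subgradient may be used there. -/
def IsAdvTrainingRun {d n : ℕ} (p : ℝ≥0∞) (ε : ℝ) (S : Fin n → Pt d) (α : ℕ → ℝ)
    (θ : ℕ → Fin d → ℝ) : Prop :=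
  θ 0 = 0 ∧
    ∀ t, ∃ g, IsSubgradient (advLoss p ε S) (θ t) g ∧ θ (t + 1) = θ t - α t • g

/-- The standard margin `max_{‖θ‖_q = 1} min_i y_i θᵀ x_i`. -/
def stdMargin {d n : ℕ} (q : ℝ≥0∞) (S : Fin n → Pt d) : ℝ :=
  sSup ((fun θ => ⨅ i, lab (S i).2 * (θ ⬝ᵥ (S i).1)) '' {θ | vecNorm q θ = 1})

/-- The adversarial margin `max_{‖θ‖₂ = 1} min_i min_{x' ∈ B(x_i)} y_i θᵀ x'`. -/
def advMargin {d n : ℕ} (p : ℝ≥0∞) (ε : ℝ) (S : Fin n → Pt d) : ℝ :=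
  sSup ((fun θ => ⨅ i, sInf ((fun x' => lab (S i).2 * (θ ⬝ᵥ x')) '' pBall p ε (S i).1)) ''
    {θ : Fin d → ℝ | vecNorm 2 θ = 1})

/-- The quantity `M` of the step-size condition, `γ` being the adversarial margin. The term
with `q - 1` has no value at `q = ∞`; it is dropped there, which gives the weakest condition
on the step size. -/
def stepM (q : ℝ≥0∞) (d : ℕ) (ε γ G : ℝ) : ℝ :=
  max ((2 * d + (if q = ⊤ then 0 else
      ε * (q.toReal - 1) * (d : ℝ) ^ ((3 * q.toReal - 2) / (2 * q.toReal - 2)) / γ)) *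
    Real.exp (-γ ^ 2 / (G * d) + ε / G)) 1

/-- The step sizes `α₀ = 1 / (G d n)` and `α_t = α` for `t ≥ 1`. -/
def stepSize (d n : ℕ) (G α : ℝ) (t : ℕ) : ℝ := if t = 0 then 1 / (G * d * n) else α

/-- The linear classifier `x ↦ sign (θᵀ x)`; its value is `0`, which is no label, on the
hyperplane `θᵀ x = 0`. -/
def classify {d : ℕ} (θ x : Fin d → ℝ) : ℝ := Real.sign (θ ⬝ᵥ x)

/-- The population adversarial risk of the linear classifier with parameter `θ`. -/
def advRisk {d : ℕ} (D : Measure (Pt d)) (p : ℝ≥0∞) (ε : ℝ) (θ : Fin d → ℝ) : ℝ :=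
  D.real {z | ∃ x' ∈ pBall p ε z.1, classify θ x' ≠ lab z.2}

/-- The quantity
`(‖μ‖₂² - 4 ε ‖μ‖_q) / ((C₂ + ε) √d) - C₃ ‖μ‖₂ log n / log t - ρ`. -/
def gap {d : ℕ} (C₂ C₃ : ℝ) (q : ℝ≥0∞) (ε : ℝ) (μ : Fin d → ℝ) (n t : ℕ) (ρ : ℝ) : ℝ :=
  (vecNorm 2 μ ^ 2 - 4 * ε * vecNorm q μ) / ((C₂ + ε) * Real.sqrt d)
    - C₃ * vecNorm 2 μ * Real.log n / Real.log t - ρ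

end AdvTraining

end

/-! Write `u i = signed (S i)` for the feature vectors multiplied by their labels. The `ℓ_p` ball is
symmetric, so the worst-case loss of point `i` is `exp (-θ ⬝ᵥ u i)` times a factor depending on `θ`
alone (`advWeight_eq`). A descent direction is therefore a combination of the `u i` with these
losses as weights `w i`, plus an error whose pairing with any `v` is at most `ε * (∑ i, w i) *
‖v‖_q` (`subgradient_add_dotProduct_le`).

With high probability the `u i` have squared length of order `d`, are nearly orthogonal, and all but
a small fraction of them satisfy `μ ⬝ᵥ u i ≥ ‖μ‖₂² / 2` (`pi_not_isGoodSample_le`). On such a sample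
a step changes `θ ⬝ᵥ u i` essentially by its own term `α * w i * ‖u i‖₂²`, so large weights shrink
fastest and all weights stay within a constant factor `A` of each other (`weight_step`,
`weights_comparable`). The few misaligned points then carry little total weight
(`weighted_alignment`). Each step has inner product at least `(∑ i, w i) * ‖μ‖₂² / 8` with `μ` per
unit of step size, and length at most `11 * √d * ∑ i, w i`. Both bounds add up over the steps, by
linearity and the triangle inequality, so for every `t ≥ 1` one gets `‖μ‖₂² ‖θ t‖₂ ≤ 88 √d (θ t ⬝ᵥ
μ)` (`run_aligned`).

An adversarial error forces `θ ⬝ᵥ signed z ≤ ε ‖θ‖_q`; for an aligned `θ` this is a sub-Gaussian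
deviation under the clean law, and passing to the noisy law costs `η` (`advRisk_le`). The condition
`B_t ≥ 0` enters once more: it bounds the perturbation radius, measured in `ℓ_2`, by `‖μ‖₂² / (100
√d)`, which makes the error term of the dynamics negligible (`gap_add_le`). -/

namespace AdvTraining

/-! ### Norms on `ℝ^d`: Hölder duality and comparison with `ℓ_2`. -/

section Norms

variable {d : ℕ}

theorem vecNorm_nonneg (r : ℝ≥0∞) (hr : 1 ≤ r) (v : Fin d → ℝ) : 0 ≤ vecNorm r v := by
  have : Fact (1 ≤ r) := ⟨hr⟩
  exact norm_nonneg _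

theorem vecNorm_smul (r : ℝ≥0∞) (hr : 1 ≤ r) (s : ℝ) (v : Fin d → ℝ) :
    vecNorm r (s • v) = |s| * vecNorm r v := by
  have : Fact (1 ≤ r) := ⟨hr⟩
  simp only [vecNorm, WithLp.toLp_smul, norm_smul, Real.norm_eq_abs]

theorem vecNorm_neg (r : ℝ≥0∞) (hr : 1 ≤ r) (v : Fin d → ℝ) :
    vecNorm r (-v) = vecNorm r v := by
  simpa using vecNorm_smul r hr (-1) v

theorem vecNorm_eq_sum (r : ℝ≥0∞) (hr : 1 ≤ r) (hr' : r ≠ ⊤) (v : Fin d → ℝ) :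
    vecNorm r v = (∑ i, |v i| ^ r.toReal) ^ (1 / r.toReal) := by
  have : 0 < r.toReal := ENNReal.toReal_pos (by positivity) hr'
  simp [vecNorm, PiLp.norm_eq_sum this]

theorem vecNorm_two_sq (v : Fin d → ℝ) : vecNorm 2 v ^ 2 = v ⬝ᵥ v := by
  rw [vecNorm, EuclideanSpace.norm_sq_eq]
  simp [dotProduct, sq]

theorem vecNorm_two_add_le (u v : Fin d → ℝ) :
    vecNorm 2 (u + v) ≤ vecNorm 2 u + vecNorm 2 v := by
  simpa only [vecNorm, WithLp.toLp_add] using norm_add_le (WithLp.toLp 2 u) (WithLp.toLp 2 v)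

theorem vecNorm_two_sum_le {ι : Type*} (s : Finset ι) (f : ι → Fin d → ℝ) :
    vecNorm 2 (∑ i ∈ s, f i) ≤ ∑ i ∈ s, vecNorm 2 (f i) := by
  simpa only [vecNorm, WithLp.toLp_sum] using norm_sum_le s fun i => WithLp.toLp 2 (f i)

theorem abs_apply_le_vecNorm (r : ℝ≥0∞) (hr : 1 ≤ r) (v : Fin d → ℝ) (i : Fin d) :
    |v i| ≤ vecNorm r v := by
  have : Fact (1 ≤ r) := ⟨hr⟩
  simpa [vecNorm] using PiLp.norm_apply_le (WithLp.toLp r v) i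

theorem one_le_of_conj {p q : ℝ≥0∞} (h : p⁻¹ + q⁻¹ = 1) : 1 ≤ q := by
  rw [← ENNReal.inv_le_one, ← h]
  exact le_add_self

theorem two_le_conj {p q : ℝ≥0∞} (hp : p ≤ 2) (h : p⁻¹ + q⁻¹ = 1) : 2 ≤ q := by
  have h1 : (2 : ℝ≥0∞)⁻¹ ≤ p⁻¹ := ENNReal.inv_le_inv.2 hp
  rw [← ENNReal.inv_le_inv]
  by_contra! hlt
  have := ENNReal.add_lt_add_of_le_of_lt (by simp) h1 hlt
  rw [ENNReal.inv_two_add_inv_two, h] at this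
  exact lt_irrefl _ this

theorem conj_le_two {p q : ℝ≥0∞} (hp : 2 ≤ p) (h : p⁻¹ + q⁻¹ = 1) : q ≤ 2 := by
  rw [← ENNReal.inv_le_inv]
  have h1 : p⁻¹ ≤ (2 : ℝ≥0∞)⁻¹ := ENNReal.inv_le_inv.2 hp
  by_contra! hlt
  have := ENNReal.add_lt_add_of_le_of_lt (ne_top_of_le_ne_top (by simp) h1) h1 hlt
  rw [ENNReal.inv_two_add_inv_two, h] at this
  exact lt_irrefl _ this

theorem abs_dotProduct_le_vecNorm_one_mul_top (u v : Fin d → ℝ) :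
    |u ⬝ᵥ v| ≤ vecNorm ⊤ u * vecNorm 1 v := by
  rw [vecNorm_eq_sum 1 le_rfl (by simp) v]
  simp only [ENNReal.toReal_one, Real.rpow_one, one_div, inv_one, dotProduct]
  refine (Finset.abs_sum_le_sum_abs _ _).trans ?_
  rw [Finset.mul_sum]
  refine Finset.sum_le_sum fun i _ => ?_
  rw [abs_mul]
  gcongr
  exact abs_apply_le_vecNorm ⊤ le_top u i

/-- Hölder's inequality for `ℓ_p` norms on `ℝ^d`. -/
theorem abs_dotProduct_le {p q : ℝ≥0∞} (hp : 1 ≤ p) (hpt : p ≠ ⊤) (h : p⁻¹ + q⁻¹ = 1)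
    (u v : Fin d → ℝ) : |u ⬝ᵥ v| ≤ vecNorm q u * vecNorm p v := by
  rcases hp.eq_or_lt with rfl | hp1
  · have hq : q = ⊤ := by
      rw [← ENNReal.inv_eq_zero]
      rw [inv_one] at h
      exact (ENNReal.add_right_inj ENNReal.one_ne_top).1 (h.trans (add_zero 1).symm)
    subst hq
    exact abs_dotProduct_le_vecNorm_one_mul_top u v
  · have hq1 := one_le_of_conj h
    have hqt : q ≠ ⊤ := by
      rintro rfl
      simp only [ENNReal.inv_top, add_zero, ENNReal.inv_eq_one] at h
      exact hp1.ne' h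
    have hconj : (q.toReal).HolderConjugate p.toReal := by
      rw [Real.holderConjugate_iff]
      have h1 : 1 < q := by
        refine lt_of_le_of_ne hq1 ?_
        rintro rfl
        rw [inv_one] at h
        have : p⁻¹ = 0 :=
          (ENNReal.add_left_inj ENNReal.one_ne_top).1 (h.trans (zero_add 1).symm)
        exact hpt (ENNReal.inv_eq_zero.1 this)
      refine ⟨by simpa using (ENNReal.toReal_lt_toReal ENNReal.one_ne_top hqt).2 h1, ?_⟩
      have := congrArg ENNReal.toReal h
      rw [ENNReal.toReal_add (by simpa using (by positivity : p ≠ 0))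
        (by simpa using (by positivity : q ≠ 0))] at this
      simpa [add_comm] using this
    rw [vecNorm_eq_sum q hq1 hqt, vecNorm_eq_sum p hp hpt]
    refine (Finset.abs_sum_le_sum_abs _ _).trans ?_
    simp only [abs_mul]
    simpa using Real.inner_le_Lp_mul_Lq Finset.univ (fun i => |u i|) (fun i => |v i|) hconj

theorem abs_dotProduct_le_two (u v : Fin d → ℝ) :
    |u ⬝ᵥ v| ≤ vecNorm 2 u * vecNorm 2 v :=
  abs_dotProduct_le (by norm_num) (by norm_num) ENNReal.inv_two_add_inv_two u v

theorem vecNorm_le_vecNorm_two {q : ℝ≥0∞} (hq : 2 ≤ q) (v : Fin d → ℝ) :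
    vecNorm q v ≤ vecNorm 2 v := by
  have h2 : ∀ i, |v i| ≤ vecNorm 2 v := abs_apply_le_vecNorm 2 (by norm_num) v
  have h0 : 0 ≤ vecNorm 2 v := vecNorm_nonneg 2 (by norm_num) v
  by_cases hqt : q = ⊤
  · subst hqt
    rw [vecNorm, PiLp.norm_eq_ciSup]
    exact Real.iSup_le (fun i => by simpa using h2 i) h0
  · have hq2 : 2 ≤ q.toReal := by
      simpa using (ENNReal.toReal_le_toReal (by simp) hqt).2 hq
    rw [vecNorm_eq_sum q (le_trans (by norm_num) hq) hqt]
    rw [one_div, Real.rpow_inv_le_iff_of_pos (Finset.sum_nonneg fun i _ => by positivity) h0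
      (by linarith)]
    -- Each coordinate is at most the `ℓ_2` norm, so `q - 2` of the powers can be pulled out of the
    -- sum.
    have hsplit : ∀ x : ℝ, 0 ≤ x → x ^ q.toReal = x ^ (q.toReal - 2) * x ^ 2 := by
      intro x hx
      rw [← Real.rpow_natCast, ← Real.rpow_add_of_nonneg hx (by linarith) (by simp)]
      congr 1
      push_cast
      ring
    calc ∑ i, |v i| ^ q.toReal ≤ ∑ i, vecNorm 2 v ^ (q.toReal - 2) * |v i| ^ 2 := by
          refine Finset.sum_le_sum fun i _ => ?_
          rw [hsplit _ (abs_nonneg _)]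
          have := h2 i
          have h3 : 0 ≤ q.toReal - 2 := by linarith
          gcongr
      _ = vecNorm 2 v ^ (q.toReal - 2) * vecNorm 2 v ^ 2 := by
          rw [← Finset.mul_sum, vecNorm_two_sq]
          simp [dotProduct, sq]
      _ = vecNorm 2 v ^ q.toReal := (hsplit _ h0).symm

theorem vecNorm_le_rpow_mul_vecNorm_two {q : ℝ≥0∞} (hq1 : 1 ≤ q) (hq : q ≤ 2)
    (v : Fin d → ℝ) : vecNorm q v ≤ (d : ℝ) ^ (1 / q.toReal - 1 / 2) * vecNorm 2 v := by
  have hqt : q ≠ ⊤ := (hq.trans_lt (by simp)).ne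
  have hq0 : 0 < q.toReal := ENNReal.toReal_pos (by positivity) hqt
  have hq2 : q.toReal ≤ 2 := by
    simpa using (ENNReal.toReal_le_toReal hqt (by simp)).2 hq
  set r := q.toReal with hr
  have h0 : 0 ≤ vecNorm 2 v := vecNorm_nonneg 2 (by norm_num) v
  -- Power mean inequality with exponent `2 / q ≥ 1`.
  have key := Real.rpow_sum_le_const_mul_sum_rpow_of_nonneg (s := Finset.univ)
    (f := fun i => |v i| ^ r) (p := 2 / r) ((one_le_div hq0).2 hq2) (fun i _ => by positivity)
  have hpow : ∀ i, (|v i| ^ r) ^ (2 / r) = v i * v i := by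
    intro i
    rw [← Real.rpow_mul (abs_nonneg _), mul_div_cancel₀ _ hq0.ne']
    rw [show (2 : ℝ) = ((2 : ℕ) : ℝ) by norm_num, Real.rpow_natCast, sq_abs, sq]
  simp only [hpow, Finset.card_univ, Fintype.card_fin] at key
  have hsum : ∑ i, v i * v i = vecNorm 2 v ^ 2 := (vecNorm_two_sq v).symm
  rw [hsum] at key
  rw [vecNorm_eq_sum q hq1 hqt, ← hr]
  set S := ∑ i, |v i| ^ r
  have hS : 0 ≤ S := Finset.sum_nonneg fun i _ => by positivity
  have hd0 : (0 : ℝ) ≤ d := by positivity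
  calc S ^ (1 / r) = (S ^ (2 / r)) ^ (1 / 2 : ℝ) := by
        rw [← Real.rpow_mul hS]; congr 1; ring
    _ ≤ ((d : ℝ) ^ (2 / r - 1) * vecNorm 2 v ^ 2) ^ (1 / 2 : ℝ) := by gcongr
    _ = (d : ℝ) ^ (1 / r - 1 / 2) * vecNorm 2 v := by
        rw [Real.mul_rpow (by positivity) (by positivity), ← Real.rpow_mul hd0,
          ← Real.sqrt_eq_rpow, Real.sqrt_sq h0]
        congr 2; ring

end Norms

/-! ### Worst-case losses as weights, and the shape of subgradients. -/

section Weights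

variable {d n : ℕ} {p q : ℝ≥0∞} {ε : ℝ}

theorem lab_eq_or (y : ℤˣ) : lab y = 1 ∨ lab y = -1 := by
  rcases Int.units_eq_one_or y with rfl | rfl <;> simp [lab]

theorem lab_mul_self (y : ℤˣ) : lab y * lab y = 1 := by
  rcases lab_eq_or y with h | h <;> simp [h]

/-- The feature vector of a labelled point, multiplied by its label. -/
def signed (z : Pt d) : Fin d → ℝ := lab z.2 • z.1

theorem dotProduct_signed (θ : Fin d → ℝ) (z : Pt d) :
    θ ⬝ᵥ signed z = lab z.2 * (θ ⬝ᵥ z.1) := by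
  simp [signed, dotProduct_smul]

/-- The worst-case exponential loss on a single labelled point. -/
noncomputable def advWeight (p : ℝ≥0∞) (ε : ℝ) (z : Pt d) (θ : Fin d → ℝ) : ℝ :=
  sSup ((fun x' => Real.exp (-(lab z.2 * (θ ⬝ᵥ x')))) '' pBall p ε z.1)

/-- The factor by which a perturbation in the `ℓ_p` ball can increase the exponential loss. -/
noncomputable def ballFactor (p : ℝ≥0∞) (ε : ℝ) (θ : Fin d → ℝ) : ℝ :=
  sSup ((fun v => Real.exp (θ ⬝ᵥ v)) '' pBall p ε 0)

theorem mem_pBall_zero {v : Fin d → ℝ} : v ∈ pBall p ε 0 ↔ vecNorm p v ≤ ε := by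
  simp [pBall]

theorem self_mem_pBall (hp : 1 ≤ p) (hε : 0 ≤ ε) (x : Fin d → ℝ) : x ∈ pBall p ε x := by
  have := vecNorm_smul p hp 0 x
  simp only [zero_smul, abs_zero, zero_mul] at this
  simpa [pBall, this] using hε

theorem dotProduct_le_of_mem_ball (hp : 1 ≤ p) (hpt : p ≠ ⊤) (h : p⁻¹ + q⁻¹ = 1)
    (θ : Fin d → ℝ) {v : Fin d → ℝ} (hv : vecNorm p v ≤ ε) :
    |θ ⬝ᵥ v| ≤ ε * vecNorm q θ := by
  have h0 := vecNorm_nonneg q (one_le_of_conj h) θ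
  calc |θ ⬝ᵥ v| ≤ vecNorm q θ * vecNorm p v := abs_dotProduct_le hp hpt h θ v
    _ ≤ vecNorm q θ * ε := by gcongr
    _ = ε * vecNorm q θ := mul_comm _ _

theorem bddAbove_ballFactor (hp : 1 ≤ p) (hpt : p ≠ ⊤) (h : p⁻¹ + q⁻¹ = 1) (θ : Fin d → ℝ) :
    BddAbove ((fun v => Real.exp (θ ⬝ᵥ v)) '' pBall p ε 0) := by
  refine ⟨Real.exp (ε * vecNorm q θ), ?_⟩
  rintro _ ⟨v, hv, rfl⟩
  exact Real.exp_le_exp.2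
    ((le_abs_self _).trans (dotProduct_le_of_mem_ball hp hpt h θ (mem_pBall_zero.1 hv)))

theorem exp_le_ballFactor (hp : 1 ≤ p) (hpt : p ≠ ⊤) (h : p⁻¹ + q⁻¹ = 1) (θ : Fin d → ℝ)
    {v : Fin d → ℝ} (hv : vecNorm p v ≤ ε) : Real.exp (θ ⬝ᵥ v) ≤ ballFactor p ε θ :=
  le_csSup (bddAbove_ballFactor hp hpt h θ) ⟨v, mem_pBall_zero.2 hv, rfl⟩

theorem ballFactor_pos (hp : 1 ≤ p) (hpt : p ≠ ⊤) (h : p⁻¹ + q⁻¹ = 1) (hε : 0 ≤ ε)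
    (θ : Fin d → ℝ) : 0 < ballFactor p ε θ :=
  (Real.exp_pos _).trans_le
    (exp_le_ballFactor hp hpt h θ (mem_pBall_zero.1 (self_mem_pBall hp hε 0)))

theorem ballFactor_le (hp : 1 ≤ p) (hε : 0 ≤ ε) {θ : Fin d → ℝ} {B : ℝ}
    (hB : ∀ v, vecNorm p v ≤ ε → Real.exp (θ ⬝ᵥ v) ≤ B) : ballFactor p ε θ ≤ B := by
  refine csSup_le ⟨_, 0, self_mem_pBall hp hε 0, rfl⟩ ?_
  rintro _ ⟨v, hv, rfl⟩
  exact hB v (mem_pBall_zero.1 hv)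

theorem ballFactor_zero (hp : 1 ≤ p) (hpt : p ≠ ⊤) (h : p⁻¹ + q⁻¹ = 1) (hε : 0 ≤ ε) :
    ballFactor p ε (0 : Fin d → ℝ) = 1 := by
  refine le_antisymm (ballFactor_le hp hε fun v _ => by simp) ?_
  simpa using exp_le_ballFactor hp hpt h (0 : Fin d → ℝ)
    (mem_pBall_zero.1 (self_mem_pBall hp hε 0))

theorem ballFactor_add_le (hp : 1 ≤ p) (hpt : p ≠ ⊤) (h : p⁻¹ + q⁻¹ = 1) (hε : 0 ≤ ε)
    (θ Δ : Fin d → ℝ) :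
    ballFactor p ε (θ + Δ) ≤ ballFactor p ε θ * Real.exp (ε * vecNorm q Δ) := by
  refine ballFactor_le hp hε fun v hv => ?_
  rw [add_dotProduct, Real.exp_add]
  have h1 := exp_le_ballFactor hp hpt h θ hv
  have h2 := (le_abs_self _).trans (dotProduct_le_of_mem_ball hp hpt h Δ hv)
  have h3 := (ballFactor_pos hp hpt h hε θ).le
  gcongr

/-- The ball is symmetric about its centre, so the label can be absorbed into the sign of the
perturbation. The second factor is the same for all sample points and cancels in ratios of weights.
-/
theorem advWeight_eq (hp : 1 ≤ p) (hpt : p ≠ ⊤) (h : p⁻¹ + q⁻¹ = 1) (hε : 0 ≤ ε)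
    (z : Pt d) (θ : Fin d → ℝ) :
    advWeight p ε z θ = Real.exp (-(θ ⬝ᵥ signed z)) * ballFactor p ε θ := by
  have hnorm : ∀ v : Fin d → ℝ, vecNorm p (-(lab z.2 • v)) = vecNorm p v := by
    intro v
    rcases lab_eq_or z.2 with hl | hl <;> simp [hl, vecNorm_neg p hp]
  have hval : ∀ v : Fin d → ℝ, Real.exp (-(lab z.2 * (θ ⬝ᵥ (z.1 + v)))) =
      Real.exp (-(θ ⬝ᵥ signed z)) * Real.exp (θ ⬝ᵥ (-(lab z.2 • v))) := by
    intro v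
    rw [← Real.exp_add, dotProduct_signed, dotProduct_add, dotProduct_neg, dotProduct_smul,
      smul_eq_mul]
    congr 1
    ring
  have hle : ∀ x' ∈ pBall p ε z.1, Real.exp (-(lab z.2 * (θ ⬝ᵥ x'))) ≤
      Real.exp (-(θ ⬝ᵥ signed z)) * ballFactor p ε θ := by
    intro x' hx'
    have := hval (x' - z.1)
    rw [add_sub_cancel] at this
    rw [this]
    gcongr
    exact exp_le_ballFactor hp hpt h θ ((hnorm _).trans_le hx')
  refine le_antisymm ?_ ?_
  · refine csSup_le ⟨_, z.1, self_mem_pBall hp hε _, rfl⟩ ?_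
    rintro _ ⟨x', hx', rfl⟩
    exact hle x' hx'
  · rw [mul_comm, ← le_div_iff₀ (Real.exp_pos _)]
    refine ballFactor_le hp hε fun v hv => ?_
    rw [le_div_iff₀ (Real.exp_pos _), mul_comm]
    have hv' := hval (-(lab z.2 • v))
    rw [show -(lab z.2 • -(lab z.2 • v)) = v by
      rw [smul_neg, neg_neg, smul_smul, lab_mul_self, one_smul]] at hv'
    rw [← hv']
    refine le_csSup ⟨Real.exp (-(θ ⬝ᵥ signed z)) * ballFactor p ε θ, ?_⟩ ⟨_, ?_, rfl⟩
    · rintro _ ⟨x', hx', rfl⟩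
      exact hle x' hx'
    · simpa [pBall, hnorm] using hv

theorem advWeight_pos (hp : 1 ≤ p) (hpt : p ≠ ⊤) (h : p⁻¹ + q⁻¹ = 1) (hε : 0 ≤ ε)
    (z : Pt d) (θ : Fin d → ℝ) : 0 < advWeight p ε z θ := by
  rw [advWeight_eq hp hpt h hε]
  exact mul_pos (Real.exp_pos _) (ballFactor_pos hp hpt h hε θ)

/-- A smooth upper bound that is exact at `Δ = 0`; differentiating it along a ray controls
subgradients of the non-smooth loss. -/
theorem advWeight_add_le (hp : 1 ≤ p) (hpt : p ≠ ⊤) (h : p⁻¹ + q⁻¹ = 1) (hε : 0 ≤ ε)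
    (z : Pt d) (θ Δ : Fin d → ℝ) :
    advWeight p ε z (θ + Δ) ≤
      advWeight p ε z θ * Real.exp (ε * vecNorm q Δ - Δ ⬝ᵥ signed z) := by
  rw [advWeight_eq hp hpt h hε, advWeight_eq hp hpt h hε, add_dotProduct, neg_add,
    Real.exp_add, sub_eq_add_neg, Real.exp_add]
  have := mul_le_mul_of_nonneg_left (ballFactor_add_le hp hpt h hε θ Δ)
    (mul_pos (Real.exp_pos (-(θ ⬝ᵥ signed z))) (Real.exp_pos (-(Δ ⬝ᵥ signed z)))).le
  refine this.trans (le_of_eq ?_)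
  ring

/-- The part of a subgradient of the adversarial loss that is due to the perturbation is bounded
by `ε` times the total weight, in the norm dual to `‖·‖_q`. -/
theorem subgradient_add_dotProduct_le (hp : 1 ≤ p) (hpt : p ≠ ⊤) (h : p⁻¹ + q⁻¹ = 1)
    (hε : 0 ≤ ε) {S : Fin n → Pt d} {θ g : Fin d → ℝ}
    (hg : IsSubgradient (advLoss p ε S) θ g) (v : Fin d → ℝ) :
    (g + ∑ i, advWeight p ε (S i) θ • signed (S i)) ⬝ᵥ v ≤
      ε * (∑ i, advWeight p ε (S i) θ) * vecNorm q v := by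
  set w := fun i => advWeight p ε (S i) θ with hw
  set c : Fin n → ℝ := fun i => ε * vecNorm q v - v ⬝ᵥ signed (S i) with hc
  -- The subgradient inequality on the ray `θ + s • v`: the two sides agree at `s = 0`, so their
  -- right derivatives there are ordered.
  have hstep : ∀ s : ℝ, 0 < s → ∑ i, w i + s * (g ⬝ᵥ v) ≤ ∑ i, w i * Real.exp (s * c i) := by
    intro s hs
    have h1 := hg (θ + s • v)
    rw [add_sub_cancel_left, dotProduct_smul, smul_eq_mul] at h1
    refine h1.trans (Finset.sum_le_sum fun i _ => ?_)
    refine (advWeight_add_le hp hpt h hε (S i) θ (s • v)).trans (le_of_eq ?_)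
    rw [vecNorm_smul q (one_le_of_conj h), abs_of_pos hs, smul_dotProduct, smul_eq_mul]
    simp only [hw, hc]
    congr 2
    ring
  have hder : HasDerivAt (fun s : ℝ => ∑ i, w i * Real.exp (s * c i)) (∑ i, w i * c i) 0 := by
    refine HasDerivAt.fun_sum fun i _ => ?_
    have := (((hasDerivAt_id (0 : ℝ)).mul_const (c i)).exp).const_mul (w i)
    simpa using this
  have hlim := hder.tendsto_slope_zero_right
  have hle : g ⬝ᵥ v ≤ ∑ i, w i * c i := by
    refine ge_of_tendsto hlim ?_
    filter_upwards [self_mem_nhdsWithin] with s hs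
    have hs' : (0 : ℝ) < s := hs
    have := hstep s hs'
    simp only [zero_add, zero_mul, Real.exp_zero, mul_one, smul_eq_mul]
    rw [inv_mul_eq_div, le_div_iff₀ hs']
    linarith
  rw [add_dotProduct, sum_dotProduct]
  have : ∑ i, w i * c i = ε * (∑ i, w i) * vecNorm q v - ∑ i, (w i • signed (S i)) ⬝ᵥ v := by
    rw [Finset.mul_sum, Finset.sum_mul, ← Finset.sum_sub_distrib]
    refine Finset.sum_congr rfl fun i _ => ?_
    rw [smul_dotProduct, smul_eq_mul, dotProduct_comm (signed (S i))]
    simp only [hc]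
    ring
  linarith

end Weights

/-! ### Deterministic analysis of the gradient steps. -/

section Dynamics

variable {d n : ℕ} {p q : ℝ≥0∞} {ε : ℝ}

theorem vecNorm_two_le_of_dotProduct_le {h : Fin d → ℝ} {b : ℝ} (hb : 0 ≤ b)
    (hh : ∀ v, h ⬝ᵥ v ≤ b * vecNorm 2 v) : vecNorm 2 h ≤ b := by
  have h1 := hh h
  rw [← vecNorm_two_sq] at h1
  by_contra! hlt
  nlinarith

theorem vecNorm_two_le_of_dotProduct_self_le {v : Fin d → ℝ} (h : v ⬝ᵥ v ≤ 100 * d) :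
    vecNorm 2 v ≤ 10 * Real.sqrt d := by
  rw [← vecNorm_two_sq] at h
  refine (abs_le_of_sq_le_sq' ?_ (by positivity)).2
  rw [mul_pow, Real.sq_sqrt (by positivity)]
  linarith

theorem vecNorm_two_step_le {u : Fin n → Fin d → ℝ} {w : Fin n → ℝ} {h : Fin d → ℝ} {r b : ℝ}
    (hr : 0 ≤ r) (hw : ∀ i, 0 ≤ w i) (hub : ∀ i, vecNorm 2 (u i) ≤ b)
    (hh : ∀ v, h ⬝ᵥ v ≤ r * (∑ i, w i) * vecNorm 2 v) :
    vecNorm 2 (∑ i, w i • u i - h) ≤ (∑ i, w i) * (b + r) := by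
  have hW : 0 ≤ ∑ i, w i := Finset.sum_nonneg fun i _ => hw i
  have h1 := vecNorm_two_le_of_dotProduct_le (mul_nonneg hr hW) hh
  have h2 : vecNorm 2 (∑ i, w i • u i) ≤ (∑ i, w i) * b := by
    refine (vecNorm_two_sum_le _ _).trans ?_
    rw [Finset.sum_mul]
    refine Finset.sum_le_sum fun i _ => ?_
    rw [vecNorm_smul 2 (by norm_num), abs_of_nonneg (hw i)]
    exact mul_le_mul_of_nonneg_left (hub i) (hw i)
  rw [sub_eq_add_neg]
  refine (vecNorm_two_add_le _ _).trans ?_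
  rw [vecNorm_neg 2 (by norm_num)]
  linarith

/-- The movement along `u i` is the contribution of point `i` itself, up to cross terms and the
perturbation error. -/
theorem abs_step_dotProduct_sub_le {u : Fin n → Fin d → ℝ} {w : Fin n → ℝ} {h : Fin d → ℝ}
    {r b c : ℝ} (hr : 0 ≤ r) (hc : 0 ≤ c) (hw : ∀ i, 0 ≤ w i)
    (hub : ∀ i, vecNorm 2 (u i) ≤ b)
    (hcross : ∀ i j, i ≠ j → |u i ⬝ᵥ u j| ≤ c)
    (hh : ∀ v, h ⬝ᵥ v ≤ r * (∑ i, w i) * vecNorm 2 v) (i : Fin n) :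
    |(∑ j, w j • u j - h) ⬝ᵥ u i - w i * (u i ⬝ᵥ u i)| ≤ (∑ j, w j) * (c + r * b) := by
  have hW : 0 ≤ ∑ i, w i := Finset.sum_nonneg fun i _ => hw i
  have hrW := mul_nonneg hr hW
  have hhu : |h ⬝ᵥ u i| ≤ r * (∑ j, w j) * b := by
    rw [abs_le']
    have h2 := hh (-u i)
    rw [dotProduct_neg, vecNorm_neg 2 (by norm_num)] at h2
    have h3 := mul_le_mul_of_nonneg_left (hub i) hrW
    exact ⟨(hh _).trans h3, h2.trans h3⟩
  have hsum : (∑ j, w j • u j - h) ⬝ᵥ u i - w i * (u i ⬝ᵥ u i) =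
      ∑ j ∈ Finset.univ.erase i, w j * (u j ⬝ᵥ u i) - h ⬝ᵥ u i := by
    rw [sub_dotProduct, sum_dotProduct, ← Finset.add_sum_erase _ _ (Finset.mem_univ i)]
    simp only [smul_dotProduct, smul_eq_mul]
    ring
  have hcr : |∑ j ∈ Finset.univ.erase i, w j * (u j ⬝ᵥ u i)| ≤ (∑ j, w j) * c := by
    refine (Finset.abs_sum_le_sum_abs _ _).trans ?_
    rw [Finset.sum_mul]
    calc ∑ j ∈ Finset.univ.erase i, |w j * (u j ⬝ᵥ u i)|
        ≤ ∑ j ∈ Finset.univ.erase i, w j * c := by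
          refine Finset.sum_le_sum fun j hj => ?_
          rw [abs_mul, abs_of_nonneg (hw j)]
          exact mul_le_mul_of_nonneg_left (hcross j i (Finset.ne_of_mem_erase hj)) (hw j)
      _ ≤ ∑ j, w j * c := Finset.sum_le_sum_of_subset_of_nonneg (Finset.erase_subset _ _)
          fun j _ _ => mul_nonneg (hw j) hc
  rw [hsum]
  refine (abs_sub _ _).trans ?_
  linarith

/-- One step of gradient descent keeps all the weights at most `1` and within a constant factor
of each other. -/
theorem weight_step {w w' Δ nsq : Fin n → ℝ} {a A s d' α c k : ℝ}
    (ha : 0 < a) (ha1 : a ≤ 1) (hA : A * a = 800) (hs : 0 ≤ s) (hsA : 4 * s * A ≤ a)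
    (hd : 0 < d') (hα : 0 ≤ α) (hαd : α * d' * 202 ≤ 1)
    (hw0 : ∀ i, 0 < w i) (hw1 : ∀ i, w i ≤ 1) (hratio : ∀ i j, w i ≤ A * w j)
    (hc : 0 < c) (hck : c ≤ Real.exp k)
    (hw' : ∀ i, w' i = w i * Real.exp (-Δ i) * c)
    (hlow : ∀ i, a * d' ≤ nsq i) (hup : ∀ i, nsq i ≤ 100 * d')
    (hk : n * k ≤ 2 * α * s * d' * ∑ j, w j)
    (hΔ : ∀ i, n * |Δ i - α * (w i * nsq i)| ≤ 2 * α * s * d' * ∑ j, w j) :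
    (∀ i, w' i ≤ w i) ∧ ∀ i j, w' i ≤ A * w' j := by
  rcases n.eq_zero_or_pos with rfl | hn
  · exact ⟨fun i => i.elim0, fun i => i.elim0⟩
  have hn' : (0 : ℝ) < n := by exact_mod_cast hn
  have hA0 : 0 < A := by
    by_contra! h
    nlinarith
  have hsum : ∀ i, ∑ j, w j ≤ n * (A * w i) := by
    intro i
    simpa using Finset.sum_le_card_nsmul Finset.univ w (A * w i) fun j _ => hratio j i
  have hαd0 : 0 ≤ α * d' := by positivity
  -- Comparability gives `∑ j, w j ≤ n * A * w i`; with `4 * s * A ≤ a` the error is at most half of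
  -- the smallest possible own contribution `α * a * d' * w i`.
  have herr : ∀ i, 2 * α * s * d' * ∑ j, w j ≤ n * (α * d' * (a / 2) * w i) := by
    intro i
    have h1 : 2 * α * s * d' * ∑ j, w j ≤ 2 * α * s * d' * (n * (A * w i)) :=
      mul_le_mul_of_nonneg_left (hsum i) (by positivity)
    have h2 : (4 * s * A) * (α * d' * n * w i) ≤ a * (α * d' * n * w i) :=
      mul_le_mul_of_nonneg_right hsA (mul_nonneg (by positivity) (hw0 i).le)
    linarith
  have hk' : ∀ i, k ≤ α * d' * (a / 2) * w i := fun i =>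
    le_of_mul_le_mul_left (hk.trans (herr i)) hn'
  have hΔ' : ∀ i, |Δ i - α * (w i * nsq i)| ≤ α * d' * (a / 2) * w i := fun i =>
    le_of_mul_le_mul_left ((hΔ i).trans (herr i)) hn'
  have hΔlow : ∀ i, α * d' * (a / 2) * w i ≤ Δ i := by
    intro i
    have h1 := (abs_le.1 (hΔ' i)).1
    have h2 : α * w i * (a * d') ≤ α * w i * nsq i :=
      mul_le_mul_of_nonneg_left (hlow i) (mul_nonneg hα (hw0 i).le)
    linarith
  have hΔup : ∀ i, Δ i ≤ 101 * (α * d' * w i) := by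
    intro i
    have h1 := (abs_le.1 (hΔ' i)).2
    have h2 : α * w i * nsq i ≤ α * w i * (100 * d') :=
      mul_le_mul_of_nonneg_left (hup i) (mul_nonneg hα (hw0 i).le)
    have h3 : (a / 2) * (α * d' * w i) ≤ 1 * (α * d' * w i) :=
      mul_le_mul_of_nonneg_right (by linarith) (mul_nonneg hαd0 (hw0 i).le)
    linarith
  refine ⟨fun i => ?_, fun i j => ?_⟩
  · rw [hw' i, mul_assoc]
    refine mul_le_of_le_one_right (hw0 i).le ?_
    calc Real.exp (-Δ i) * c ≤ Real.exp (-Δ i) * Real.exp k := by gcongr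
      _ = Real.exp (k - Δ i) := by rw [← Real.exp_add]; congr 1; ring
      _ ≤ 1 := Real.exp_le_one_iff.2 (by linarith [hk' i, hΔlow i])
  · rw [hw' i, hw' j, ← mul_assoc]
    refine mul_le_mul_of_nonneg_right ?_ hc.le
    rw [← mul_assoc]
    have hwj := mul_nonneg hαd0 (hw0 j).le
    have hwi := mul_nonneg hαd0 (hw0 i).le
    -- If the ratio is already at least `A / 2`, then `A * a = 800` gives `Δ i ≥ 200 * α * d' * w j
    -- ≥ Δ j`, and the ratio does not grow. Otherwise it at most doubles, since `Δ j ≤ 101 * α * d'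
    -- ≤ 1 / 2`.
    rcases le_or_gt (A / 2 * w j) (w i) with hcase | hcase
    · have h1 : Δ j ≤ Δ i := by
        refine (hΔup j).trans (le_trans ?_ (hΔlow i))
        have h2 : (α * d' * (a / 2)) * (A / 2 * w j) ≤ (α * d' * (a / 2)) * w i :=
          mul_le_mul_of_nonneg_left hcase (by positivity)
        have h3 : (α * d' * (a / 2)) * (A / 2 * w j) = (A * a) / 4 * (α * d' * w j) := by ring
        rw [h3, hA] at h2
        linarith
      have h4 := hratio i j
      have h5 : 0 ≤ A * w j := (hw0 i).le.trans h4
      gcongr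
    · have h1 : Real.exp (-Δ i) ≤ 1 := by
        refine Real.exp_le_one_iff.2 ?_
        have : 0 ≤ (a / 2) * (α * d' * w i) := by positivity
        linarith [hΔlow i]
      have h2 : 1 / 2 ≤ Real.exp (-Δ j) := by
        have h3 : α * d' * w j ≤ α * d' := mul_le_of_le_one_right hαd0 (hw1 j)
        linarith [Real.add_one_le_exp (-Δ j), hΔup j]
      calc w i * Real.exp (-Δ i) ≤ w i := mul_le_of_le_one_right (hw0 i).le h1
        _ ≤ A * w j * (1 / 2) := by linarith
        _ ≤ A * w j * Real.exp (-Δ j) := by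
          have := hw0 j
          gcongr

theorem exists_run_step (hp : 1 ≤ p) (hpt : p ≠ ⊤) (h : p⁻¹ + q⁻¹ = 1) (hε : 0 ≤ ε)
    {r : ℝ} (hrq : ∀ v : Fin d → ℝ, ε * vecNorm q v ≤ r * vecNorm 2 v)
    {S : Fin n → Pt d} {α : ℕ → ℝ} {θ : ℕ → Fin d → ℝ} (hrun : IsAdvTrainingRun p ε S α θ)
    (t : ℕ) :
    ∃ g : Fin d → ℝ,
      θ (t + 1) = θ t + α t • (∑ i, advWeight p ε (S i) (θ t) • signed (S i) - g) ∧
      (∀ v, g ⬝ᵥ v ≤ ε * (∑ i, advWeight p ε (S i) (θ t)) * vecNorm q v) ∧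
      ∀ v, g ⬝ᵥ v ≤ r * (∑ i, advWeight p ε (S i) (θ t)) * vecNorm 2 v := by
  obtain ⟨g, hg, hθ⟩ := hrun.2 t
  have key := subgradient_add_dotProduct_le hp hpt h hε hg
  refine ⟨_, ?_, key, fun v => (key v).trans ?_⟩
  · rw [hθ, sub_eq_add_neg, ← smul_neg]
    congr 2
    abel
  · have hW : 0 ≤ ∑ i, advWeight p ε (S i) (θ t) :=
      Finset.sum_nonneg fun i _ => (advWeight_pos hp hpt h hε _ _).le
    have := mul_le_mul_of_nonneg_left (hrq v) hW
    linarith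

/-- Along a run of adversarial training on a sample whose signed points are nearly orthogonal and
of comparable length, the weights stay within a constant factor of each other. -/
theorem weights_comparable (hp : 1 ≤ p) (hpt : p ≠ ⊤) (h : p⁻¹ + q⁻¹ = 1) (hε : 0 ≤ ε)
    {r a A s : ℝ} (hr : 0 ≤ r) (hrq : ∀ v : Fin d → ℝ, ε * vecNorm q v ≤ r * vecNorm 2 v)
    {S : Fin n → Pt d} {α : ℕ → ℝ} {θ : ℕ → Fin d → ℝ} (hrun : IsAdvTrainingRun p ε S α θ)
    (hn : 0 < n) (hd : 0 < d)
    (ha : 0 < a) (ha1 : a ≤ 1) (hA : A * a = 800) (hs : 0 ≤ s) (hsA : 4 * s * A ≤ a)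
    (hα : ∀ t, 0 ≤ α t) (hαd : ∀ t, α t * d * 202 ≤ 1)
    (hlow : ∀ i, a * d ≤ signed (S i) ⬝ᵥ signed (S i))
    (hup : ∀ i, signed (S i) ⬝ᵥ signed (S i) ≤ 100 * d)
    (hcross : ∀ i j, i ≠ j → |signed (S i) ⬝ᵥ signed (S j)| ≤ s * d / n)
    (hrn : r * n * 10 ≤ s * Real.sqrt d) (t : ℕ) :
    ∀ i j, advWeight p ε (S i) (θ t) ≤ A * advWeight p ε (S j) (θ t) := by
  have hn' : (0 : ℝ) < n := by exact_mod_cast hn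
  have hn1 : (1 : ℝ) ≤ n := by exact_mod_cast hn
  have hd' : (0 : ℝ) < d := by exact_mod_cast hd
  have hA1 : 1 ≤ A := by
    by_contra! hlt
    nlinarith
  have hs1 : s ≤ 1 := by nlinarith
  have hsq : Real.sqrt d * Real.sqrt d = d := Real.mul_self_sqrt hd'.le
  have hsq0 : 0 < Real.sqrt d := Real.sqrt_pos.2 hd'
  have hub : ∀ i, vecNorm 2 (signed (S i)) ≤ 10 * Real.sqrt d := fun i =>
    vecNorm_two_le_of_dotProduct_self_le (hup i)
  have hr1 : r ≤ Real.sqrt d := by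
    have : r * 1 ≤ r * n := mul_le_mul_of_nonneg_left hn1 hr
    nlinarith
  -- The bound by `1` is carried through the induction because it limits how much one step can
  -- change a ratio.
  have main : (∀ i, advWeight p ε (S i) (θ t) ≤ 1) ∧
      ∀ i j, advWeight p ε (S i) (θ t) ≤ A * advWeight p ε (S j) (θ t) := by
    induction t with
    | zero =>
      have h1 : ∀ i, advWeight p ε (S i) (θ 0) = 1 := by
        intro i
        rw [advWeight_eq hp hpt h hε, hrun.1, ballFactor_zero hp hpt h hε]
        simp
      simp only [h1, mul_one]
      exact ⟨fun _ => le_rfl, fun _ _ => hA1⟩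
    | succ t ih =>
      obtain ⟨g, hθ, -, hg⟩ := exists_run_step hp hpt h hε hrq hrun t
      set w := fun i => advWeight p ε (S i) (θ t) with hw
      set u := fun i => signed (S i) with hu
      set v := ∑ i, w i • u i - g with hv
      have hw0 : ∀ i, 0 < w i := fun i => advWeight_pos hp hpt h hε _ _
      have hW : 0 < ∑ i, w i :=
        Finset.sum_pos (fun i _ => hw0 i) ⟨⟨0, hn⟩, Finset.mem_univ _⟩
      have hnorm := vecNorm_two_step_le hr (fun i => (hw0 i).le) hub hg
      have hdot := abs_step_dotProduct_sub_le (c := s * d / n) hr (by positivity)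
        (fun i => (hw0 i).le) hub hcross hg
      have hKpos := ballFactor_pos (d := d) hp hpt h hε
      have hrd : r * n * (10 * Real.sqrt d) ≤ s * d := by
        have := mul_le_mul_of_nonneg_right hrn hsq0.le
        rw [mul_assoc s, hsq] at this
        linarith
      -- The common factor `c` is the ratio of the ball factors after and before the step.
      have step := weight_step (w := w) (w' := fun i => advWeight p ε (S i) (θ (t + 1)))
        (Δ := fun i => α t * (v ⬝ᵥ u i)) (nsq := fun i => u i ⬝ᵥ u i) (d' := d) (α := α t)
        (c := ballFactor p ε (θ (t + 1)) / ballFactor p ε (θ t)) (k := ε * vecNorm q (α t • v))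
        ha ha1 hA hs hsA hd' (hα t) (hαd t) hw0 ih.1 ih.2 (div_pos (hKpos _) (hKpos _))
        ?_ ?_ hlow hup ?_ ?_
      · exact ⟨fun i => (step.1 i).trans (ih.1 i), step.2⟩
      · rw [div_le_iff₀ (hKpos _), mul_comm, hθ]
        exact ballFactor_add_le hp hpt h hε _ _
      · intro i
        simp only [hw]
        have := (hKpos (θ t)).ne'
        rw [advWeight_eq hp hpt h hε, advWeight_eq hp hpt h hε, hθ, add_dotProduct,
          smul_dotProduct, smul_eq_mul, neg_add, Real.exp_add]
        field_simp
        exact mul_comm _ _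
      · have h1 := hrq (α t • v)
        rw [vecNorm_smul 2 (by norm_num), abs_of_nonneg (hα t)] at h1
        have h2 : r * (α t * vecNorm 2 v) ≤
            r * (α t * ((∑ i, w i) * (10 * Real.sqrt d + r))) := by
          have := hα t
          gcongr
        have h3 : (n * r * (10 * Real.sqrt d + r)) * (α t * ∑ i, w i) ≤
            (2 * s * d) * (α t * ∑ i, w i) := by
          refine mul_le_mul_of_nonneg_right ?_ (mul_nonneg (hα t) hW.le)
          have h4 : n * r * r ≤ n * r * Real.sqrt d := by gcongr
          have h5 : 0 ≤ n * r * Real.sqrt d := by positivity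
          linarith
        have h6 := mul_le_mul_of_nonneg_left (h1.trans h2) hn'.le
        linarith
      · intro i
        have h1 : α t * (v ⬝ᵥ u i) - α t * (w i * (u i ⬝ᵥ u i)) =
            α t * (v ⬝ᵥ u i - w i * (u i ⬝ᵥ u i)) := by ring
        rw [h1, abs_mul, abs_of_nonneg (hα t)]
        have h2 : α t * |v ⬝ᵥ u i - w i * (u i ⬝ᵥ u i)| ≤
            α t * ((∑ j, w j) * (s * d / n + r * (10 * Real.sqrt d))) :=
          mul_le_mul_of_nonneg_left (hdot i) (hα t)
        have h3 : (n * (s * d / n + r * (10 * Real.sqrt d))) * (α t * ∑ i, w i) ≤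
            (2 * s * d) * (α t * ∑ i, w i) := by
          refine mul_le_mul_of_nonneg_right ?_ (mul_nonneg (hα t) hW.le)
          rw [mul_add, mul_div_cancel₀ _ hn'.ne']
          linarith
        have h6 := mul_le_mul_of_nonneg_left h2 hn'.le
        linarith
  exact main.2

/-- If comparable weights are put on the points of a sample, most of which are correctly aligned
with `μ`, the weighted sum of the points is aligned with `μ`. -/
theorem weighted_alignment {w m : Fin n → ℝ} {A c b : ℝ} (hn : 0 < n) (hA : 0 ≤ A) (hb : 0 ≤ b)
    (hw : ∀ i, 0 ≤ w i) (hratio : ∀ i j, w i ≤ A * w j) (hm : ∀ i, -(3 / 2 * b) ≤ m i)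
    (hbad : ((Finset.univ.filter fun i => m i < b / 2).card : ℝ) ≤ c * n) (hc : 8 * c * A ≤ 1) :
    (∑ i, w i) * (b / 4) ≤ ∑ i, w i * m i := by
  have hn' : (0 : ℝ) < n := by exact_mod_cast hn
  have hW : 0 ≤ ∑ i, w i := Finset.sum_nonneg fun i _ => hw i
  -- No weight exceeds `A` times the average, so the bad points carry at most a fraction `c * A ≤ 1
  -- / 8` of the total.
  have h1 : ∀ i, n * w i ≤ A * ∑ j, w j := by
    intro i
    have := Finset.card_nsmul_le_sum Finset.univ (fun j => A * w j) (w i) fun j _ => hratio i j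
    simpa [Finset.mul_sum] using this
  set B := Finset.univ.filter fun i => m i < b / 2
  have h2 : n * ∑ i ∈ B, w i ≤ n * (c * A * ∑ j, w j) := by
    rw [Finset.mul_sum]
    calc ∑ i ∈ B, n * w i ≤ ∑ i ∈ B, A * ∑ j, w j := Finset.sum_le_sum fun i _ => h1 i
      _ = B.card * (A * ∑ j, w j) := by simp
      _ ≤ (c * n) * (A * ∑ j, w j) := by gcongr
      _ = n * (c * A * ∑ j, w j) := by ring
  have h3 : ∑ i ∈ B, w i ≤ (∑ j, w j) / 8 := by
    have h4 := le_of_mul_le_mul_left h2 hn'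
    have h5 := mul_le_mul_of_nonneg_right hc hW
    linarith
  -- A bad point lowers the baseline `b / 2` by at most `2 * b`, since `m i ≥ -3 / 2 * b`. The net
  -- bound is `b / 2 - 2 * b / 8 = b / 4`.
  have h6 : ∑ i, (w i * (b / 2) - if i ∈ B then w i * (2 * b) else 0) ≤ ∑ i, w i * m i := by
    refine Finset.sum_le_sum fun i _ => ?_
    split_ifs with hi
    · have := mul_le_mul_of_nonneg_left (hm i) (hw i)
      linarith
    · have h7 : b / 2 ≤ m i := by
        simpa [B] using hi
      have := mul_le_mul_of_nonneg_left h7 (hw i)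
      linarith
  rw [Finset.sum_sub_distrib, ← Finset.sum_mul, ← Finset.sum_filter, Finset.filter_mem_eq_inter,
    Finset.univ_inter, ← Finset.sum_mul] at h6
  have h8 := mul_le_mul_of_nonneg_right h3 hb
  linarith

/-- Along a run of adversarial training with comparable weights, the parameter is aligned
with `μ`. -/
theorem run_aligned (hp : 1 ≤ p) (hpt : p ≠ ⊤) (h : p⁻¹ + q⁻¹ = 1) (hε : 0 ≤ ε)
    {r A c : ℝ} (hr : 0 ≤ r) (hrq : ∀ v : Fin d → ℝ, ε * vecNorm q v ≤ r * vecNorm 2 v)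
    {S : Fin n → Pt d} {α : ℕ → ℝ} {θ : ℕ → Fin d → ℝ} (hrun : IsAdvTrainingRun p ε S α θ)
    (hn : 0 < n) (hA : 0 ≤ A) (hα : ∀ t, 0 < α t)
    (hratio : ∀ t i j, advWeight p ε (S i) (θ t) ≤ A * advWeight p ε (S j) (θ t))
    {μ : Fin d → ℝ} (hμ : 0 < μ ⬝ᵥ μ) (hεμ : 8 * (ε * vecNorm q μ) ≤ μ ⬝ᵥ μ)
    (hm : ∀ i, -(3 / 2 * (μ ⬝ᵥ μ)) ≤ μ ⬝ᵥ signed (S i))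
    (hbad : ((Finset.univ.filter fun i => μ ⬝ᵥ signed (S i) < μ ⬝ᵥ μ / 2).card : ℝ) ≤ c * n)
    (hc : 8 * c * A ≤ 1)
    (hub : ∀ i, vecNorm 2 (signed (S i)) ≤ 10 * Real.sqrt d)
    (hrd : r ≤ Real.sqrt d) (t : ℕ) (ht : 1 ≤ t) :
    0 < θ t ⬝ᵥ μ ∧ μ ⬝ᵥ μ * vecNorm 2 (θ t) ≤ 88 * Real.sqrt d * (θ t ⬝ᵥ μ) := by
  have inc : ∀ t, 0 < (θ (t + 1) - θ t) ⬝ᵥ μ ∧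
      μ ⬝ᵥ μ * vecNorm 2 (θ (t + 1) - θ t) ≤
        88 * Real.sqrt d * ((θ (t + 1) - θ t) ⬝ᵥ μ) := by
    intro t
    obtain ⟨g, hθ, hgq, hg⟩ := exists_run_step hp hpt h hε hrq hrun t
    set w := fun i => advWeight p ε (S i) (θ t) with hw
    have hw0 : ∀ i, 0 < w i := fun i => advWeight_pos hp hpt h hε _ _
    have hW : 0 < ∑ i, w i :=
      Finset.sum_pos (fun i _ => hw0 i) ⟨⟨0, hn⟩, Finset.mem_univ _⟩
    have hnorm := vecNorm_two_step_le hr (fun i => (hw0 i).le) hub hg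
    have hal := weighted_alignment hn hA hμ.le (fun i => (hw0 i).le) (hratio t) hm hbad hc
    -- Of the alignment `‖μ‖₂² / 4` the perturbation takes at most `ε ‖μ‖_q ≤ ‖μ‖₂² / 8`. With step
    -- length `11 √d` this gives the constant `88 = 8 * 11`.
    have hdot : (∑ i, w i) * (μ ⬝ᵥ μ / 8) ≤ (∑ i, w i • signed (S i) - g) ⬝ᵥ μ := by
      rw [sub_dotProduct, sum_dotProduct]
      simp only [dotProduct_smul, smul_eq_mul, dotProduct_comm _ μ] at hal ⊢
      have h1 := hgq μ
      rw [dotProduct_comm] at h1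
      have h2 := mul_le_mul_of_nonneg_left hεμ hW.le
      linarith
    have hsq0 := Real.sqrt_nonneg (d : ℝ)
    have hpos : 0 < (∑ i, w i) * (μ ⬝ᵥ μ / 8) := by positivity
    rw [hθ, add_sub_cancel_left, smul_dotProduct, smul_eq_mul, vecNorm_smul 2 (by norm_num),
      abs_of_pos (hα t)]
    refine ⟨mul_pos (hα t) (hpos.trans_le hdot), ?_⟩
    have h3 : μ ⬝ᵥ μ * vecNorm 2 (∑ i, w i • signed (S i) - g) ≤
        88 * Real.sqrt d * ((∑ i, w i • signed (S i) - g) ⬝ᵥ μ) := by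
      calc μ ⬝ᵥ μ * vecNorm 2 (∑ i, w i • signed (S i) - g)
          ≤ μ ⬝ᵥ μ * ((∑ i, w i) * (10 * Real.sqrt d + Real.sqrt d)) := by
            refine mul_le_mul_of_nonneg_left (hnorm.trans ?_) hμ.le
            gcongr
        _ = 88 * Real.sqrt d * ((∑ i, w i) * (μ ⬝ᵥ μ / 8)) := by ring
        _ ≤ _ := by gcongr
    have := mul_le_mul_of_nonneg_left h3 (hα t).le
    linarith
  induction t, ht using Nat.le_induction with
  | base => simpa [hrun.1] using inc 0
  | succ t _ ih =>
    have hi := inc t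
    have heq : θ (t + 1) = θ t + (θ (t + 1) - θ t) := by abel
    rw [heq, add_dotProduct]
    refine ⟨add_pos ih.1 hi.1, ?_⟩
    have := mul_le_mul_of_nonneg_left (vecNorm_two_add_le (θ t) (θ (t + 1) - θ t)) hμ.le
    linarith [ih.2, hi.2]

end Dynamics

/-! ### One-dimensional sub-Gaussian moment and exponential bounds. -/

section SubGaussian

variable {ν : Measure ℝ}

/-- The supremum defining the norm, evaluated at `r = 2 * k`. -/
theorem lintegral_enorm_pow_le (hν : subGaussianNorm ν ≤ 1) {k : ℕ} (hk : k ≠ 0) :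
    ∫⁻ x, ‖x‖ₑ ^ (2 * k) ∂ν ≤ ENNReal.ofReal ((2 * k : ℝ) ^ k) := by
  have hk1 : (1 : ℝ) ≤ k := by exact_mod_cast Nat.one_le_iff_ne_zero.2 hk
  set r : ℝ := 2 * k with hr
  have hr1 : 1 ≤ r := by linarith
  have hr0 : 0 < r := by linarith
  have h1 : ENNReal.ofReal (r ^ (-(1 / 2) : ℝ)) *
      eLpNorm (fun x : ℝ => x) (ENNReal.ofReal r) ν ≤ 1 :=
    (le_iSup (fun r : {r : ℝ // 1 ≤ r} => ENNReal.ofReal ((r : ℝ) ^ (-(1 / 2) : ℝ)) *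
      eLpNorm (fun x : ℝ => x) (ENNReal.ofReal r) ν) ⟨r, hr1⟩).trans hν
  rw [eLpNorm_eq_lintegral_rpow_enorm_toReal (by simpa using hr0) (by simp),
    ENNReal.toReal_ofReal hr0.le] at h1
  have h2 : ∀ x : ℝ, ‖x‖ₑ ^ r = ‖x‖ₑ ^ (2 * k) := by
    intro x
    rw [← ENNReal.rpow_natCast]
    congr 1
    push_cast
    rfl
  simp only [h2] at h1
  set I := ∫⁻ x, ‖x‖ₑ ^ (2 * k) ∂ν
  have h3 : I ^ (1 / r) ≤ ENNReal.ofReal (r ^ (1 / 2 : ℝ)) := by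
    calc I ^ (1 / r) = ENNReal.ofReal (r ^ (1 / 2 : ℝ)) *
          (ENNReal.ofReal (r ^ (-(1 / 2) : ℝ)) * I ^ (1 / r)) := by
            rw [← mul_assoc, ← ENNReal.ofReal_mul (by positivity), ← Real.rpow_add hr0]
            simp
      _ ≤ ENNReal.ofReal (r ^ (1 / 2 : ℝ)) * 1 := by gcongr
      _ = _ := mul_one _
  have h4 := ENNReal.rpow_le_rpow h3 hr0.le
  rw [← ENNReal.rpow_mul, one_div_mul_cancel hr0.ne', ENNReal.rpow_one,
    ENNReal.ofReal_rpow_of_nonneg (by positivity) hr0.le, ← Real.rpow_mul hr0.le] at h4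
  refine h4.trans (le_of_eq ?_)
  rw [← Real.rpow_natCast]
  congr 2
  rw [hr]
  ring

/-- Expanding the exponential, the `k`-th term is at most `(2β)^k k^k / k! ≤ (6β)^k` because `e ≤
3`. The geometric sum `1 / (1 - 6β)` is at most `1 + 12β` for `β ≤ 1 / 12`. -/
theorem lintegral_exp_mul_sq_le [IsProbabilityMeasure ν] (hν : subGaussianNorm ν ≤ 1) {β : ℝ}
    (hβ : 0 ≤ β) (hβ' : β ≤ 1 / 12) :
    ∫⁻ x, ENNReal.ofReal (Real.exp (β * x ^ 2)) ∂ν ≤ ENNReal.ofReal (Real.exp (12 * β)) := by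
  have hterm : ∀ k : ℕ, ∫⁻ x, ENNReal.ofReal ((β * x ^ 2) ^ k / k.factorial) ∂ν ≤
      ENNReal.ofReal ((6 * β) ^ k) := by
    intro k
    rcases eq_or_ne k 0 with rfl | hk
    · simp
    have h1 : ∀ x : ℝ, ENNReal.ofReal ((β * x ^ 2) ^ k / k.factorial) =
        ENNReal.ofReal (β ^ k / k.factorial) * ‖x‖ₑ ^ (2 * k) := by
      intro x
      rw [← ofReal_norm, ← ENNReal.ofReal_pow (norm_nonneg _),
        ← ENNReal.ofReal_mul (by positivity), Real.norm_eq_abs, pow_mul |x|, sq_abs]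
      congr 1
      ring
    simp only [h1]
    rw [lintegral_const_mul _ (by fun_prop)]
    calc _ ≤ ENNReal.ofReal (β ^ k / k.factorial) * ENNReal.ofReal ((2 * k : ℝ) ^ k) := by
          gcongr
          exact lintegral_enorm_pow_le hν hk
      _ = ENNReal.ofReal ((2 * β) ^ k * ((k : ℝ) ^ k / k.factorial)) := by
          rw [← ENNReal.ofReal_mul (by positivity)]
          congr 1
          ring
      _ ≤ ENNReal.ofReal ((6 * β) ^ k) := by
          refine ENNReal.ofReal_le_ofReal ?_
          have h2 : (k : ℝ) ^ k / k.factorial ≤ 3 ^ k := by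
            refine (Real.pow_div_factorial_le_exp _ (Nat.cast_nonneg k) k).trans ?_
            rw [← mul_one (k : ℝ), Real.exp_nat_mul]
            gcongr
            linarith [Real.exp_one_lt_d9]
          calc (2 * β) ^ k * ((k : ℝ) ^ k / k.factorial) ≤ (2 * β) ^ k * 3 ^ k := by gcongr
            _ = (6 * β) ^ k := by rw [← mul_pow]; congr 1; ring
  have hexp : ∀ x : ℝ, ENNReal.ofReal (Real.exp (β * x ^ 2)) =
      ∑' k : ℕ, ENNReal.ofReal ((β * x ^ 2) ^ k / k.factorial) := by
    intro x
    rw [← ENNReal.ofReal_tsum_of_nonneg (fun k => by positivity)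
      (Real.summable_pow_div_factorial _), Real.exp_eq_exp_ℝ, NormedSpace.exp_eq_tsum_div]
  simp only [hexp]
  rw [lintegral_tsum (fun k => by fun_prop)]
  refine (ENNReal.tsum_le_tsum hterm).trans ?_
  rw [← ENNReal.ofReal_tsum_of_nonneg (fun k => by positivity)
    (summable_geometric_of_lt_one (by positivity) (by linarith)),
    tsum_geometric_of_lt_one (by positivity) (by linarith)]
  refine ENNReal.ofReal_le_ofReal (le_trans ?_ (Real.add_one_le_exp _))
  rw [inv_le_iff_one_le_mul₀ (by linarith)]
  nlinarith

theorem integrable_exp_mul_sq [IsProbabilityMeasure ν] (hν : subGaussianNorm ν ≤ 1) {β : ℝ}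
    (hβ : 0 ≤ β) (hβ' : β ≤ 1 / 12) : Integrable (fun x => Real.exp (β * x ^ 2)) ν := by
  refine ⟨by fun_prop, ?_⟩
  rw [hasFiniteIntegral_iff_ofReal (ae_of_all _ fun x => (Real.exp_pos _).le)]
  exact (lintegral_exp_mul_sq_le hν hβ hβ').trans_lt ENNReal.ofReal_lt_top

theorem integral_exp_mul_sq_le [IsProbabilityMeasure ν] (hν : subGaussianNorm ν ≤ 1) {β : ℝ}
    (hβ : 0 ≤ β) (hβ' : β ≤ 1 / 12) :
    ∫ x, Real.exp (β * x ^ 2) ∂ν ≤ Real.exp (12 * β) := by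
  rw [integral_eq_lintegral_of_nonneg_ae (ae_of_all _ fun x => (Real.exp_pos _).le)
    (by fun_prop)]
  exact ENNReal.toReal_le_of_le_ofReal (Real.exp_pos _).le (lintegral_exp_mul_sq_le hν hβ hβ')

/-- For a centred variable the linear term integrates to zero, leaving an exponential moment of the
square. -/
theorem exp_le_add_exp_sq (x : ℝ) : Real.exp x ≤ x + Real.exp (x ^ 2) := by
  have h1 := Real.add_one_le_exp (x ^ 2)
  rcases le_or_gt |x| 1 with hx | hx
  · have h2 := (abs_le.1 (Real.abs_exp_sub_one_sub_id_le hx)).2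
    linarith
  · rcases lt_abs.1 hx with h | h
    · have : Real.exp x ≤ Real.exp (x ^ 2) := Real.exp_le_exp.2 (by nlinarith)
      linarith
    · have : Real.exp x ≤ 1 := Real.exp_le_one_iff.2 (by linarith)
      nlinarith

theorem integrable_sq_pow (hν : subGaussianNorm ν ≤ 1) {k : ℕ} (hk : k ≠ 0) :
    Integrable (fun x : ℝ => (x ^ 2) ^ k) ν := by
  refine ⟨by fun_prop, ?_⟩
  refine lt_of_le_of_lt (le_of_eq ?_)
    ((lintegral_enorm_pow_le hν hk).trans_lt ENNReal.ofReal_lt_top)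
  refine lintegral_congr fun x => ?_
  rw [enorm_pow, enorm_pow, pow_mul]

theorem integral_sq_pow_le (hν : subGaussianNorm ν ≤ 1) {k : ℕ} (hk : k ≠ 0) :
    ∫ x, (x ^ 2) ^ k ∂ν ≤ (2 * k : ℝ) ^ k := by
  rw [integral_eq_lintegral_of_nonneg_ae (ae_of_all _ fun x => by positivity) (by fun_prop)]
  refine ENNReal.toReal_le_of_le_ofReal (by positivity)
    (le_trans (le_of_eq (lintegral_congr fun x => ?_)) (lintegral_enorm_pow_le hν hk))
  rw [← ofReal_norm, ← ENNReal.ofReal_pow (norm_nonneg _), pow_mul, Real.norm_eq_abs,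
    sq_abs]

theorem integrable_of_subGaussianNorm_le [IsProbabilityMeasure ν] (hν : subGaussianNorm ν ≤ 1) :
    Integrable (fun x : ℝ => x) ν := by
  have h := (integrable_sq_pow hν one_ne_zero).add (integrable_const (1 : ℝ))
  refine h.mono' (by fun_prop) (ae_of_all _ fun x => ?_)
  simp only [Pi.add_apply, pow_one, Real.norm_eq_abs]
  nlinarith [sq_abs x, sq_nonneg (|x| - 1)]

/-- A centred random variable of sub-Gaussian norm at most `1` has a sub-Gaussian moment
generating function. -/
theorem hasSubgaussianMGF_id [IsProbabilityMeasure ν] (hν : subGaussianNorm ν ≤ 1)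
    (hmean : ∫ x, x ∂ν = 0) :
    ProbabilityTheory.HasSubgaussianMGF (fun x : ℝ => x) 30 ν := by
  -- This is `(6 * t - x) ^ 2 ≥ 0`; it is meant for large `t`.
  have hpt : ∀ t x : ℝ, Real.exp (t * x) ≤
      Real.exp (3 * t ^ 2) * Real.exp (1 / 12 * x ^ 2) := by
    intro t x
    rw [← Real.exp_add]
    refine Real.exp_le_exp.2 ?_
    nlinarith [sq_nonneg (6 * t - x)]
  have hI := integrable_exp_mul_sq hν (β := 1 / 12) (by norm_num) le_rfl
  have hint : ∀ t : ℝ, Integrable (fun x => Real.exp (t * x)) ν := by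
    intro t
    refine (hI.const_mul (Real.exp (3 * t ^ 2))).mono' (by fun_prop) (ae_of_all _ fun x => ?_)
    rw [Real.norm_of_nonneg (Real.exp_pos _).le]
    exact hpt t x
  refine ⟨hint, fun t => ?_⟩
  rw [ProbabilityTheory.mgf]
  -- For small `t` the exponent is `12 * t ^ 2`; for large `t` it is `3 * t ^ 2 + 1`, which is at
  -- most `15 * t ^ 2` exactly from the threshold on. Hence the variance proxy `30`.
  rcases le_or_gt (t ^ 2) (1 / 12) with ht | ht
  · have hI' := integrable_exp_mul_sq hν (sq_nonneg t) ht
    have hid := (integrable_of_subGaussianNorm_le hν).const_mul t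
    calc ∫ x, Real.exp (t * x) ∂ν ≤ ∫ x, (t * x + Real.exp (t ^ 2 * x ^ 2)) ∂ν := by
          refine integral_mono (hint t) (hid.add hI') fun x => ?_
          have := exp_le_add_exp_sq (t * x)
          rwa [mul_pow] at this
      _ = ∫ x, Real.exp (t ^ 2 * x ^ 2) ∂ν := by
          rw [integral_add hid hI', integral_const_mul, hmean]
          simp
      _ ≤ Real.exp (12 * t ^ 2) := integral_exp_mul_sq_le hν (sq_nonneg t) ht
      _ ≤ _ := Real.exp_le_exp.2 (by push_cast; nlinarith [sq_nonneg t])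
  · calc ∫ x, Real.exp (t * x) ∂ν
        ≤ ∫ x, Real.exp (3 * t ^ 2) * Real.exp (1 / 12 * x ^ 2) ∂ν :=
          integral_mono (hint t) (hI.const_mul _) (hpt t)
      _ ≤ Real.exp (3 * t ^ 2) * Real.exp (12 * (1 / 12)) := by
          rw [integral_const_mul]
          gcongr
          exact integral_exp_mul_sq_le hν (by norm_num) le_rfl
      _ ≤ _ := by
          rw [← Real.exp_add]
          exact Real.exp_le_exp.2 (by push_cast; linarith)

theorem exp_neg_le_quadratic {x : ℝ} (hx : 0 ≤ x) : Real.exp (-x) ≤ 1 - x + x ^ 2 / 2 := by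
  have h := Real.quadratic_le_exp_of_nonneg hx
  rw [Real.exp_neg, inv_le_iff_one_le_mul₀ (Real.exp_pos x)]
  have h2 : 0 < 1 - x + x ^ 2 / 2 := by nlinarith [sq_nonneg (x - 1)]
  -- The product equals `1 + x ^ 4 / 4`.
  calc (1 : ℝ) ≤ (1 - x + x ^ 2 / 2) * (1 + x + x ^ 2 / 2) := by nlinarith [sq_nonneg (x ^ 2)]
    _ ≤ (1 - x + x ^ 2 / 2) * Real.exp x := by gcongr

theorem integral_exp_neg_mul_sq_le [IsProbabilityMeasure ν] (hν : subGaussianNorm ν ≤ 1)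
    {κ l : ℝ} (hκ : κ ≤ ∫ x, x ^ 2 ∂ν) (hl : 0 ≤ l) :
    ∫ x, Real.exp (-l * x ^ 2) ∂ν ≤ Real.exp (-l * κ + 8 * l ^ 2) := by
  have h2 : Integrable (fun x : ℝ => x ^ 2) ν := by
    simpa using integrable_sq_pow hν one_ne_zero
  have h4 := integrable_sq_pow hν two_ne_zero
  have h4' : ∫ x, (x ^ 2) ^ 2 ∂ν ≤ 16 := by
    refine (integral_sq_pow_le hν two_ne_zero).trans (by norm_num)
  calc ∫ x, Real.exp (-l * x ^ 2) ∂ν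
      ≤ ∫ x, (1 - l * x ^ 2 + l ^ 2 / 2 * (x ^ 2) ^ 2) ∂ν := by
        refine integral_mono_of_nonneg (ae_of_all _ fun x => (Real.exp_pos _).le)
          (((integrable_const _).sub (h2.const_mul l)).add (h4.const_mul _))
          (ae_of_all _ fun x => ?_)
        have := exp_neg_le_quadratic (x := l * x ^ 2) (by positivity)
        simp only [neg_mul]
        refine this.trans (le_of_eq ?_)
        ring
    _ = 1 - l * ∫ x, x ^ 2 ∂ν + l ^ 2 / 2 * ∫ x, (x ^ 2) ^ 2 ∂ν := by
        have h5 : Integrable (fun x : ℝ => 1 - l * x ^ 2) ν :=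
          (integrable_const _).sub (h2.const_mul l)
        rw [integral_add h5 (h4.const_mul _),
          integral_sub (integrable_const _) (h2.const_mul l), integral_const_mul,
          integral_const_mul]
        simp
    _ ≤ (-l * κ + 8 * l ^ 2) + 1 := by
        have h5 := mul_le_mul_of_nonneg_left hκ hl
        have h6 := mul_le_mul_of_nonneg_left h4' (show 0 ≤ l ^ 2 / 2 by positivity)
        linarith
    _ ≤ _ := Real.add_one_le_exp _

end SubGaussian

/-! ### Concentration of the noise vector. -/

section Noise

variable {d : ℕ} {ν : Measure ℝ} [IsProbabilityMeasure ν]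

instance : IsProbabilityMeasure (noiseLaw d ν) := by
  unfold noiseLaw
  infer_instance

theorem hasSubgaussianMGF_dotProduct (hν : subGaussianNorm ν ≤ 1) (hmean : ∫ x, x ∂ν = 0)
    (v : Fin d → ℝ) :
    ProbabilityTheory.HasSubgaussianMGF (fun ξ => v ⬝ᵥ ξ) (30 * (v ⬝ᵥ v).toNNReal)
      (noiseLaw d ν) := by
  have h1 := hasSubgaussianMGF_id hν hmean
  have hprod : ∀ (t : ℝ) (ξ : Fin d → ℝ), Real.exp (t * (v ⬝ᵥ ξ)) =
      ∏ i, Real.exp (t * v i * ξ i) := by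
    intro t ξ
    rw [← Real.exp_sum, dotProduct, Finset.mul_sum]
    congr 1
    exact Finset.sum_congr rfl fun i _ => by ring
  have hvv : 0 ≤ v ⬝ᵥ v := by
    rw [← vecNorm_two_sq]
    positivity
  refine ⟨fun t => ?_, fun t => ?_⟩
  · simp only [hprod]
    exact Integrable.fintype_prod (f := fun i x => Real.exp (t * v i * x))
      fun i => h1.integrable_exp_mul (t * v i)
  · rw [ProbabilityTheory.mgf]
    simp only [hprod]
    rw [noiseLaw, integral_fintype_prod_eq_prod (fun i x => Real.exp (t * v i * x))]
    calc ∏ i, ∫ x, Real.exp (t * v i * x) ∂ν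
        ≤ ∏ i, Real.exp (30 * (t * v i) ^ 2 / 2) := by
          refine Finset.prod_le_prod (fun i _ => integral_nonneg fun x => (Real.exp_pos _).le)
            fun i _ => ?_
          simpa [ProbabilityTheory.mgf] using h1.mgf_le (t * v i)
      _ = _ := by
          rw [← Real.exp_sum]
          congr 1
          push_cast
          rw [Real.coe_toNNReal _ hvv, dotProduct, Finset.mul_sum, Finset.sum_mul,
            Finset.sum_div]
          exact Finset.sum_congr rfl fun i _ => by ring

theorem noise_dotProduct_ge_le (hν : subGaussianNorm ν ≤ 1) (hmean : ∫ x, x ∂ν = 0)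
    (v : Fin d → ℝ) {m : ℝ} (hm : 0 ≤ m) :
    (noiseLaw d ν).real {ξ | m ≤ v ⬝ᵥ ξ} ≤ Real.exp (-m ^ 2 / (60 * (v ⬝ᵥ v))) := by
  have hvv : 0 ≤ v ⬝ᵥ v := by
    rw [← vecNorm_two_sq]
    positivity
  refine ((hasSubgaussianMGF_dotProduct hν hmean v).measure_ge_le hm).trans (le_of_eq ?_)
  push_cast
  rw [Real.coe_toNNReal _ hvv]
  congr 2
  ring

theorem noise_abs_dotProduct_ge_le (hν : subGaussianNorm ν ≤ 1) (hmean : ∫ x, x ∂ν = 0)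
    (v : Fin d → ℝ) {m : ℝ} (hm : 0 ≤ m) :
    (noiseLaw d ν).real {ξ | m ≤ |v ⬝ᵥ ξ|} ≤ 2 * Real.exp (-m ^ 2 / (60 * (v ⬝ᵥ v))) := by
  have h1 := noise_dotProduct_ge_le hν hmean v hm
  have h2 := noise_dotProduct_ge_le hν hmean (-v) hm
  simp only [neg_dotProduct, dotProduct_neg, neg_neg] at h2
  have hsub : {ξ : Fin d → ℝ | m ≤ |v ⬝ᵥ ξ|} ⊆ {ξ | m ≤ v ⬝ᵥ ξ} ∪ {ξ | m ≤ -(v ⬝ᵥ ξ)} :=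
    fun ξ (hξ : m ≤ |v ⬝ᵥ ξ|) => (le_abs.1 hξ : m ≤ v ⬝ᵥ ξ ∨ m ≤ -(v ⬝ᵥ ξ))
  have h3 := (measureReal_mono (μ := noiseLaw d ν) hsub).trans (measureReal_union_le _ _)
  linarith

theorem noise_sq_ge_le (hν : subGaussianNorm ν ≤ 1) :
    (noiseLaw d ν).real {ξ | 36 * (d : ℝ) ≤ ξ ⬝ᵥ ξ} ≤ Real.exp (-2 * d) := by
  have hprod : ∀ ξ : Fin d → ℝ, Real.exp (1 / 12 * (ξ ⬝ᵥ ξ)) =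
      ∏ i, Real.exp (1 / 12 * ξ i ^ 2) := by
    intro ξ
    rw [← Real.exp_sum, dotProduct, Finset.mul_sum]
    congr 1
    exact Finset.sum_congr rfl fun i _ => by ring
  have hI := integrable_exp_mul_sq hν (β := 1 / 12) (by norm_num) le_rfl
  have h1 := ProbabilityTheory.measure_ge_le_exp_mul_mgf (μ := noiseLaw d ν)
    (X := fun ξ => ξ ⬝ᵥ ξ) (t := 1 / 12) (36 * d) (by norm_num) (by
      simp only [hprod]
      exact Integrable.fintype_prod (f := fun _ x => Real.exp (1 / 12 * x ^ 2)) fun _ => hI)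
  refine h1.trans ?_
  rw [ProbabilityTheory.mgf]
  simp only [hprod]
  rw [noiseLaw, integral_fintype_prod_eq_pow (fun x => Real.exp (1 / 12 * x ^ 2)),
    Fintype.card_fin]
  calc Real.exp (-(1 / 12) * (36 * d)) * (∫ x, Real.exp (1 / 12 * x ^ 2) ∂ν) ^ d
      ≤ Real.exp (-(1 / 12) * (36 * d)) * Real.exp (12 * (1 / 12)) ^ d := by
        have h0 : 0 ≤ ∫ x, Real.exp (1 / 12 * x ^ 2) ∂ν :=
          integral_nonneg fun x => (Real.exp_pos _).le
        gcongr
        exact integral_exp_mul_sq_le hν (by norm_num) le_rfl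
    _ = _ := by
        rw [← Real.exp_nat_mul, ← Real.exp_add]
        congr 1
        ring

/-- Chernoff's bound for the lower tail: with parameter `-l` the exponent per coordinate is `-l * κ
/ 2 + 8 * l ^ 2`, minimal at `l = κ / 32`. -/
theorem noise_sq_le_le (hν : subGaussianNorm ν ≤ 1) {κ : ℝ} (hκ0 : 0 ≤ κ)
    (hκ : κ ≤ ∫ x, x ^ 2 ∂ν) :
    (noiseLaw d ν).real {ξ | ξ ⬝ᵥ ξ ≤ κ / 2 * d} ≤ Real.exp (-(κ ^ 2 / 128 * d)) := by
  have hprod : ∀ ξ : Fin d → ℝ, Real.exp (-(κ / 32) * (ξ ⬝ᵥ ξ)) =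
      ∏ i, Real.exp (-(κ / 32) * ξ i ^ 2) := by
    intro ξ
    rw [← Real.exp_sum, dotProduct, Finset.mul_sum]
    congr 1
    exact Finset.sum_congr rfl fun i _ => by ring
  have hI : Integrable (fun x : ℝ => Real.exp (-(κ / 32) * x ^ 2)) ν := by
    refine (integrable_const (1 : ℝ)).mono' (by fun_prop) (ae_of_all _ fun x => ?_)
    rw [Real.norm_of_nonneg (Real.exp_pos _).le]
    exact Real.exp_le_one_iff.2 (by nlinarith [sq_nonneg x])
  have h1 := ProbabilityTheory.measure_le_le_exp_mul_mgf (μ := noiseLaw d ν)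
    (X := fun ξ => ξ ⬝ᵥ ξ) (t := -(κ / 32)) (κ / 2 * d) (by linarith) (by
      simp only [hprod]
      exact Integrable.fintype_prod (f := fun _ x => Real.exp (-(κ / 32) * x ^ 2)) fun _ => hI)
  refine h1.trans ?_
  rw [ProbabilityTheory.mgf]
  simp only [hprod]
  rw [noiseLaw, integral_fintype_prod_eq_pow (fun x => Real.exp (-(κ / 32) * x ^ 2)),
    Fintype.card_fin]
  calc Real.exp (- -(κ / 32) * (κ / 2 * d)) * (∫ x, Real.exp (-(κ / 32) * x ^ 2) ∂ν) ^ d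
      ≤ Real.exp (- -(κ / 32) * (κ / 2 * d)) *
          Real.exp (-(κ / 32) * κ + 8 * (κ / 32) ^ 2) ^ d := by
        have h0 : 0 ≤ ∫ x, Real.exp (-(κ / 32) * x ^ 2) ∂ν :=
          integral_nonneg fun x => (Real.exp_pos _).le
        gcongr
        exact integral_exp_neg_mul_sq_le hν hκ (by linarith)
    _ = _ := by
        rw [← Real.exp_nat_mul, ← Real.exp_add]
        congr 1
        ring

theorem le_variance_of_le_integral_vecNorm_sq (hν : subGaussianNorm ν ≤ 1) (hd : 0 < d) {κ : ℝ}
    (h : κ * d ≤ ∫ ξ, vecNorm 2 ξ ^ 2 ∂(noiseLaw d ν)) : κ ≤ ∫ x, x ^ 2 ∂ν := by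
  have h2 : Integrable (fun x : ℝ => x ^ 2) ν := by
    simpa using integrable_sq_pow hν one_ne_zero
  have heq : ∫ ξ, vecNorm 2 ξ ^ 2 ∂(noiseLaw d ν) = (∫ x, x ^ 2 ∂ν) * d := by
    have h3 : ∀ ξ : Fin d → ℝ, vecNorm 2 ξ ^ 2 = ∑ i, ξ i ^ 2 := by
      intro ξ
      rw [vecNorm_two_sq]
      simp [dotProduct, sq]
    simp only [h3, noiseLaw]
    rw [integral_finsetSum _ fun i _ => integrable_comp_eval (μ := fun _ : Fin d => ν) h2]
    have h4 : ∀ i : Fin d, ∫ ξ : Fin d → ℝ, ξ i ^ 2 ∂(Measure.pi fun _ => ν) = ∫ x, x ^ 2 ∂ν :=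
      fun i => integral_comp_eval (μ := fun _ : Fin d => ν) (f := fun x => x ^ 2) (by fun_prop)
    simp [h4, mul_comm]
  rw [heq] at h
  exact le_of_mul_le_mul_right h (by exact_mod_cast hd)

end Noise

/-! ### Clean and noisy laws of a single labelled point. -/

section Law

variable {d : ℕ} {ν : Measure ℝ} [IsProbabilityMeasure ν] {μ : Fin d → ℝ}

instance : MeasurableSingletonClass ℤˣ where
  measurableSet_singleton y := by
    refine ⟨{(y : ℤ)}, measurableSet_singleton _, ?_⟩
    ext y'
    simp [Units.ext_iff]

theorem measurable_lab : Measurable lab := measurable_of_finite lab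

theorem measurable_cleanMap (μ : Fin d → ℝ) :
    Measurable fun w : ℤˣ × (Fin d → ℝ) => ((lab w.1 • μ + w.2, w.1) : Pt d) := by
  have h : Measurable fun w : ℤˣ × (Fin d → ℝ) => lab w.1 • μ :=
    (measurable_of_finite fun y : ℤˣ => lab y • μ).comp measurable_fst
  exact (h.add measurable_snd).prodMk measurable_fst

instance : IsProbabilityMeasure (cleanLaw ν μ) :=
  Measure.isProbabilityMeasure_map (measurable_cleanMap μ).aemeasurable

theorem cleanLaw_real {A : Set (Pt d)} (hA : MeasurableSet A) :
    (cleanLaw ν μ).real A =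
      ((noiseLaw d ν).real {ξ | ((lab 1 • μ + ξ, 1) : Pt d) ∈ A} +
        (noiseLaw d ν).real {ξ | ((lab (-1) • μ + ξ, -1) : Pt d) ∈ A}) / 2 := by
  have hm := measurable_cleanMap μ hA
  rw [measureReal_def, cleanLaw, Measure.map_apply (measurable_cleanMap μ) hA,
    Measure.prod_apply hm, lintegral_fintype]
  have hu : (Finset.univ : Finset ℤˣ) = {1, -1} := by decide
  rw [ENNReal.toReal_sum fun y _ => ENNReal.mul_ne_top (measure_ne_top _ _) (measure_ne_top _ _)]
  simp only [ENNReal.toReal_mul, PMF.toMeasure_apply_singleton _ _ (measurableSet_singleton _),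
    PMF.uniformOfFintype_apply, Fintype.card_units_int]
  rw [hu, Finset.sum_pair (by decide), ← add_mul]
  simp only [Nat.cast_ofNat, ENNReal.toReal_inv, ENNReal.toReal_ofNat]
  rw [← div_eq_mul_inv]
  rfl

theorem cleanLaw_real_le {A : Set (Pt d)} (hA : MeasurableSet A) {b : ℝ}
    (h : ∀ y : ℤˣ, (noiseLaw d ν).real {ξ | ((lab y • μ + ξ, y) : Pt d) ∈ A} ≤ b) :
    (cleanLaw ν μ).real A ≤ b := by
  rw [cleanLaw_real hA]
  linarith [h 1, h (-1)]

theorem real_le_of_tvDist_le {Ω : Type*} [MeasurableSpace Ω] {P Q : Measure Ω}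
    [IsProbabilityMeasure P] [IsProbabilityMeasure Q] {η : ℝ} (h : tvDist P Q ≤ η) {A : Set Ω}
    (hA : MeasurableSet A) : P.real A ≤ Q.real A + η := by
  have hb : BddAbove (Set.range fun A : {A : Set Ω // MeasurableSet A} =>
      |P.real A - Q.real A|) := by
    refine ⟨1, ?_⟩
    rintro _ ⟨B, rfl⟩
    have h1 := measureReal_nonneg (μ := P) (s := B)
    have h2 := measureReal_nonneg (μ := Q) (s := B)
    have h3 := measureReal_le_one (μ := P) (s := B)
    have h4 := measureReal_le_one (μ := Q) (s := B)
    exact abs_le.2 ⟨by linarith, by linarith⟩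
  have h1 := (le_ciSup hb ⟨A, hA⟩).trans h
  linarith [le_abs_self (P.real A - Q.real A)]

/-- Events about features alone pass to the clean law without losing `η`, so they can hold for all
sample points at once. -/
theorem real_preimage_fst_eq {D D' : Measure (Pt d)} {η : ℝ} (h : IsNoisyVersion D D' η)
    {A : Set (Fin d → ℝ)} (hA : MeasurableSet A) :
    D.real (Prod.fst ⁻¹' A) = D'.real (Prod.fst ⁻¹' A) := by
  have := congrArg (fun m => m A) h.1
  simp only [Measure.map_apply measurable_fst hA] at this
  rw [measureReal_def, measureReal_def, this]

theorem measurable_dotProduct_left (v : Fin d → ℝ) : Measurable fun x : Fin d → ℝ => v ⬝ᵥ x := by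
  unfold dotProduct
  fun_prop

theorem measurable_dotProduct_self : Measurable fun x : Fin d → ℝ => x ⬝ᵥ x := by
  unfold dotProduct
  fun_prop

theorem measurable_dotProduct_signed (v : Fin d → ℝ) :
    Measurable fun z : Pt d => v ⬝ᵥ signed z := by
  simp only [dotProduct_signed]
  exact (measurable_lab.comp measurable_snd).mul
    ((measurable_dotProduct_left v).comp measurable_fst)

theorem dotProduct_signed_clean (v ξ : Fin d → ℝ) (y : ℤˣ) :
    v ⬝ᵥ signed ((lab y • μ + ξ, y) : Pt d) = v ⬝ᵥ μ + (lab y • v) ⬝ᵥ ξ := by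
  rw [dotProduct_signed]
  simp only [dotProduct_add, dotProduct_smul, smul_dotProduct, smul_eq_mul]
  linear_combination (v ⬝ᵥ μ) * lab_mul_self y

theorem smul_lab_dotProduct_self (v : Fin d → ℝ) (y : ℤˣ) :
    (lab y • v) ⬝ᵥ (lab y • v) = v ⬝ᵥ v := by
  simp only [dotProduct_smul, smul_dotProduct, smul_eq_mul]
  linear_combination (v ⬝ᵥ v) * lab_mul_self y

theorem cleanLaw_dotProduct_signed_le (hν : subGaussianNorm ν ≤ 1) (hmean : ∫ x, x ∂ν = 0)
    (v : Fin d → ℝ) {b m : ℝ} (hm : 0 ≤ m) (hb : b + m ≤ v ⬝ᵥ μ) :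
    (cleanLaw ν μ).real {z | v ⬝ᵥ signed z ≤ b} ≤ Real.exp (-m ^ 2 / (60 * (v ⬝ᵥ v))) := by
  refine cleanLaw_real_le (measurableSet_le (measurable_dotProduct_signed v) measurable_const)
    fun y => ?_
  have h1 := noise_dotProduct_ge_le hν hmean (-(lab y • v)) hm
  rw [neg_dotProduct_neg, smul_lab_dotProduct_self] at h1
  refine (measureReal_mono fun ξ hξ => ?_).trans h1
  simp only [Set.mem_ofPred_eq, dotProduct_signed_clean, neg_dotProduct] at hξ ⊢
  linarith

/-- The adversarial risk of a linear classifier that is well aligned with `μ`. -/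
theorem advRisk_le {D : Measure (Pt d)} [IsProbabilityMeasure D] {η ε : ℝ} {p q : ℝ≥0∞}
    (hp : 1 ≤ p) (hpt : p ≠ ⊤) (h : p⁻¹ + q⁻¹ = 1)
    (hν : subGaussianNorm ν ≤ 1) (hmean : ∫ x, x ∂ν = 0)
    (hD : IsNoisyVersion D (cleanLaw ν μ) η) {θ : Fin d → ℝ} {b : ℝ} (hb : 0 ≤ b)
    (hθ : 0 < vecNorm 2 θ) (hal : ε * vecNorm q θ + b * vecNorm 2 θ ≤ θ ⬝ᵥ μ) :
    advRisk D p ε θ ≤ η + Real.exp (-(1 / 60) * b ^ 2) := by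
  set A : Set (Pt d) := {z | θ ⬝ᵥ signed z ≤ ε * vecNorm q θ} with hA
  have hAm : MeasurableSet A :=
    measurableSet_le (measurable_dotProduct_signed θ) measurable_const
  -- A perturbation moves `θ ⬝ᵥ x` by at most `ε ‖θ‖_q`. The set `A` is closed under ties, and its
  -- measurability replaces that of the error event.
  have hsub : {z : Pt d | ∃ x' ∈ pBall p ε z.1, classify θ x' ≠ lab z.2} ⊆ A := by
    rintro z ⟨x', hx', hne⟩
    have h1 := dotProduct_le_of_mem_ball hp hpt h θ hx'
    rw [dotProduct_sub] at h1
    simp only [hA, Set.mem_ofPred_eq, dotProduct_signed]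
    rcases lab_eq_or z.2 with hl | hl
    · rw [hl] at hne ⊢
      have : θ ⬝ᵥ x' ≤ 0 := by
        by_contra! hpos
        exact hne (Real.sign_of_pos hpos)
      linarith [(abs_le.1 h1).1]
    · rw [hl] at hne ⊢
      have : 0 ≤ θ ⬝ᵥ x' := by
        by_contra! hneg
        exact hne (Real.sign_of_neg hneg)
      linarith [(abs_le.1 h1).2]
  have h2 := cleanLaw_dotProduct_signed_le hν hmean θ (mul_nonneg hb hθ.le) hal
  have h3 : -(b * vecNorm 2 θ) ^ 2 / (60 * (θ ⬝ᵥ θ)) = -(1 / 60) * b ^ 2 := by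
    rw [← vecNorm_two_sq]
    field_simp
  rw [h3] at h2
  have h4 := real_le_of_tvDist_le hD.2 hAm
  have h5 : advRisk D p ε θ ≤ D.real A := measureReal_mono hsub
  linarith

/-- A point that is neither too short nor too long, nor too far from the centres along `μ`. -/
def IsTypical (κ : ℝ) (μ x : Fin d → ℝ) : Prop :=
  κ / 2 * d ≤ x ⬝ᵥ x ∧ x ⬝ᵥ x ≤ 100 * d ∧ |μ ⬝ᵥ x| ≤ 3 / 2 * (μ ⬝ᵥ μ)

theorem measurableSet_isTypical (κ : ℝ) (μ : Fin d → ℝ) :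
    MeasurableSet {x | IsTypical κ μ x} :=
  (measurableSet_le measurable_const measurable_dotProduct_self).inter
    ((measurableSet_le measurable_dotProduct_self measurable_const).inter
      (measurableSet_le (measurable_dotProduct_left μ).abs measurable_const))

theorem clean_dotProduct_self (ξ : Fin d → ℝ) (y : ℤˣ) :
    (lab y • μ + ξ) ⬝ᵥ (lab y • μ + ξ) = μ ⬝ᵥ μ + 2 * (lab y * (μ ⬝ᵥ ξ)) + ξ ⬝ᵥ ξ := by
  simp only [add_dotProduct, dotProduct_add, smul_dotProduct, dotProduct_smul, smul_eq_mul,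
    dotProduct_comm ξ μ]
  linear_combination (μ ⬝ᵥ μ) * lab_mul_self y

theorem abs_lab_mul (y : ℤˣ) (a : ℝ) : |lab y * a| = |a| := by
  rcases lab_eq_or y with h | h <;> simp [h]

/-- When `|μ ⬝ᵥ ξ| < ‖μ‖₂² / 2`, the cross term in the squared length is dominated by `‖μ‖₂²`, so
the length bounds reduce to those for `ξ`. -/
theorem cleanLaw_not_isTypical_le (hν : subGaussianNorm ν ≤ 1) (hmean : ∫ x, x ∂ν = 0) {κ : ℝ}
    (hκ0 : 0 ≤ κ) (hκ : κ ≤ ∫ x, x ^ 2 ∂ν) (hμd : μ ⬝ᵥ μ ≤ d) :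
    (cleanLaw ν μ).real (Prod.fst ⁻¹' {x | IsTypical κ μ x}ᶜ) ≤
      Real.exp (-2 * d) + Real.exp (-(κ ^ 2 / 128 * d)) +
        2 * Real.exp (-(μ ⬝ᵥ μ / 240)) := by
  have hμ0 : 0 ≤ μ ⬝ᵥ μ := by
    rw [← vecNorm_two_sq]
    positivity
  refine cleanLaw_real_le (measurable_fst (measurableSet_isTypical κ μ).compl) fun y => ?_
  have h1 := noise_sq_ge_le (d := d) hν
  have h2 := noise_sq_le_le (d := d) hν hκ0 hκ
  have h3 := noise_abs_dotProduct_ge_le hν hmean μ (m := μ ⬝ᵥ μ / 2) (by linarith)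
  have h4 : -(μ ⬝ᵥ μ / 2) ^ 2 / (60 * (μ ⬝ᵥ μ)) = -(μ ⬝ᵥ μ / 240) := by
    rcases hμ0.eq_or_lt with h | h
    · simp [← h]
    · field_simp
      ring
  rw [h4] at h3
  have hsub : {ξ | ((lab y • μ + ξ, y) : Pt d) ∈ Prod.fst ⁻¹' {x | IsTypical κ μ x}ᶜ} ⊆
      ({ξ | 36 * (d : ℝ) ≤ ξ ⬝ᵥ ξ} ∪ {ξ | ξ ⬝ᵥ ξ ≤ κ / 2 * d}) ∪
        {ξ | μ ⬝ᵥ μ / 2 ≤ |μ ⬝ᵥ ξ|} := by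
    intro ξ hξ
    by_contra hcon
    simp only [Set.mem_union, Set.mem_ofPred_eq, not_or, not_le] at hcon
    obtain ⟨⟨hc1, hc2⟩, hc3⟩ := hcon
    refine hξ ?_
    simp only [Set.mem_ofPred_eq, IsTypical, clean_dotProduct_self]
    have hc4 := abs_lt.1 ((abs_lab_mul y (μ ⬝ᵥ ξ)).trans_lt hc3)
    refine ⟨by linarith, by linarith, ?_⟩
    rw [dotProduct_add, dotProduct_smul, smul_eq_mul]
    refine (abs_add_le _ _).trans ?_
    rw [abs_lab_mul, abs_of_nonneg hμ0]
    linarith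
  have h5 := (measureReal_mono (μ := noiseLaw d ν) hsub).trans (measureReal_union_le _ _)
  have h6 := measureReal_union_le (μ := noiseLaw d ν) {ξ | 36 * (d : ℝ) ≤ ξ ⬝ᵥ ξ}
    {ξ | ξ ⬝ᵥ ξ ≤ κ / 2 * d}
  linarith

theorem cleanLaw_abs_dotProduct_ge_le (hν : subGaussianNorm ν ≤ 1) (hmean : ∫ x, x ∂ν = 0)
    {v : Fin d → ℝ} {c : ℝ} (hc : 0 ≤ c) (hμv : |v ⬝ᵥ μ| ≤ c / 2) (hv0 : 0 < v ⬝ᵥ v)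
    (hv : v ⬝ᵥ v ≤ 100 * d) :
    (cleanLaw ν μ).real (Prod.fst ⁻¹' {x | c < |v ⬝ᵥ x|}) ≤
      2 * Real.exp (-(c ^ 2 / (24000 * d))) := by
  refine cleanLaw_real_le (measurable_fst (measurableSet_lt measurable_const
    (measurable_dotProduct_left v).abs)) fun y => ?_
  have h3 := noise_abs_dotProduct_ge_le hν hmean v (m := c / 2) (by linarith)
  have h4 : Real.exp (-(c / 2) ^ 2 / (60 * (v ⬝ᵥ v))) ≤ Real.exp (-(c ^ 2 / (24000 * d))) := by
    refine Real.exp_le_exp.2 ?_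
    rw [neg_div, neg_le_neg_iff]
    calc c ^ 2 / (24000 * d) = (c / 2) ^ 2 / (60 * (100 * d)) := by ring
      _ ≤ (c / 2) ^ 2 / (60 * (v ⬝ᵥ v)) := by gcongr
  refine (measureReal_mono fun ξ hξ => ?_).trans (h3.trans (by linarith))
  simp only [Set.mem_preimage, Set.mem_ofPred_eq, dotProduct_add, dotProduct_smul,
    smul_eq_mul] at hξ ⊢
  have h5 := abs_add_le (lab y * (v ⬝ᵥ μ)) (v ⬝ᵥ ξ)
  rw [abs_lab_mul] at h5
  linarith

/-- The noise need not be symmetric, but the two labels turn the event into `v ⬝ᵥ ξ < 0` and `0 < v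
⬝ᵥ ξ`. These are disjoint, and their probabilities are averaged. -/
theorem cleanLaw_dotProduct_signed_lt_le_half (v : Fin d → ℝ) :
    (cleanLaw ν μ).real {z | v ⬝ᵥ signed z < v ⬝ᵥ μ} ≤ 1 / 2 := by
  rw [cleanLaw_real (measurableSet_lt (measurable_dotProduct_signed v) measurable_const)]
  simp only [Set.mem_ofPred_eq, dotProduct_signed_clean]
  have h1 : lab 1 = 1 := by simp [lab]
  have h2 : lab (-1) = -1 := by simp [lab]
  simp only [h1, h2, one_smul, neg_smul, neg_dotProduct, add_lt_iff_neg_left, Left.neg_neg_iff]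
  have hdisj : Disjoint {ξ : Fin d → ℝ | v ⬝ᵥ ξ < 0} {ξ | 0 < v ⬝ᵥ ξ} :=
    Set.disjoint_left.2 fun ξ (h1 : v ⬝ᵥ ξ < 0) (h2 : 0 < v ⬝ᵥ ξ) => lt_asymm h1 h2
  have h3 := measureReal_union (μ := noiseLaw d ν) hdisj
    (measurableSet_lt measurable_const (measurable_dotProduct_left v))
  have h4 := measureReal_le_one (μ := noiseLaw d ν)
    (s := {ξ : Fin d → ℝ | v ⬝ᵥ ξ < 0} ∪ {ξ | 0 < v ⬝ᵥ ξ})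
  linarith

/-- Here `‖a + b‖² ≤ 2‖a‖² + 2‖b‖²` replaces control of `μ ⬝ᵥ ξ`, so no lower bound on `‖μ‖₂` is
needed. -/
theorem cleanLaw_dotProduct_self_gt_le (hν : subGaussianNorm ν ≤ 1) (hμd : μ ⬝ᵥ μ ≤ d) :
    (cleanLaw ν μ).real (Prod.fst ⁻¹' {x | 100 * (d : ℝ) < x ⬝ᵥ x}) ≤ Real.exp (-2 * d) := by
  refine cleanLaw_real_le (measurable_fst (measurableSet_lt measurable_const
    measurable_dotProduct_self)) fun y => ?_
  refine (measureReal_mono fun ξ hξ => ?_).trans (noise_sq_ge_le hν)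
  simp only [Set.mem_preimage, Set.mem_ofPred_eq, clean_dotProduct_self] at hξ ⊢
  have h1 : (lab y • μ - ξ) ⬝ᵥ (lab y • μ - ξ) =
      μ ⬝ᵥ μ - 2 * (lab y * (μ ⬝ᵥ ξ)) + ξ ⬝ᵥ ξ := by
    simp only [sub_dotProduct, dotProduct_sub, smul_dotProduct, dotProduct_smul, smul_eq_mul,
      dotProduct_comm ξ μ]
    linear_combination (μ ⬝ᵥ μ) * lab_mul_self y
  have h2 : 0 ≤ (lab y • μ - ξ) ⬝ᵥ (lab y • μ - ξ) := by
    rw [← vecNorm_two_sq]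
    positivity
  linarith

end Law

/-! ### Events for i.i.d. samples. -/

section Sample

variable {d n : ℕ} {D : Measure (Pt d)} [IsProbabilityMeasure D]

theorem pi_real_eval (i : Fin n) {A : Set (Pt d)} (hA : MeasurableSet A) :
    (Measure.pi fun _ : Fin n => D).real {S | S i ∈ A} = D.real A := by
  have h := (measurePreserving_eval (fun _ : Fin n => D) i).measure_preimage
    hA.nullMeasurableSet
  rw [measureReal_def, measureReal_def]
  exact congrArg ENNReal.toReal h

/-- Independence and Fubini: a bound conditional on the first point, uniform in its value, suffices.
-/
theorem pi_real_pair_le {i j : Fin n} (hij : i ≠ j) {A : Set (Pt d × Pt d)}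
    (hA : MeasurableSet A) {b : ℝ} (hb : 0 ≤ b) (h : ∀ z, D.real {z' | (z, z') ∈ A} ≤ b) :
    (Measure.pi fun _ : Fin n => D).real {S | (S i, S j) ∈ A} ≤ b := by
  have hind : ProbabilityTheory.IndepFun (fun S : Fin n → Pt d => S i) (fun S => S j)
      (Measure.pi fun _ => D) := (ProbabilityTheory.iIndepFun_pi (μ := fun _ : Fin n => D)
    (X := fun _ z => z) fun _ => aemeasurable_id).indepFun hij
  have hmap := (ProbabilityTheory.indepFun_iff_map_prod_eq_prod_map_map
    (measurable_pi_apply i).aemeasurable (measurable_pi_apply j).aemeasurable).1 hind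
  have hi := (measurePreserving_eval (fun _ : Fin n => D) i).map_eq
  have hj := (measurePreserving_eval (fun _ : Fin n => D) j).map_eq
  rw [show (fun S : Fin n → Pt d => S i) = Function.eval i from rfl,
    show (fun S : Fin n → Pt d => S j) = Function.eval j from rfl, hi, hj] at hmap
  have h1 : (Measure.pi fun _ : Fin n => D) {S | (S i, S j) ∈ A} = (D.prod D) A := by
    rw [← hmap, Measure.map_apply (by fun_prop) hA]
    rfl
  rw [measureReal_def, h1, Measure.prod_apply hA]
  refine ENNReal.toReal_le_of_le_ofReal hb ?_
  calc ∫⁻ z, D (Prod.mk z ⁻¹' A) ∂D ≤ ∫⁻ _, ENNReal.ofReal b ∂D := by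
        refine lintegral_mono fun z => ?_
        rw [ENNReal.le_ofReal_iff_toReal_le (measure_ne_top _ _) hb]
        exact h z
    _ = ENNReal.ofReal b := by simp

/-- Chernoff's bound with parameter `3 / c`: the threshold contributes `exp (-3 n)`, and each factor
of the moment generating function is at most `2 ≤ e`. -/
theorem pi_real_count_le {B : Set (Pt d)} [DecidablePred (· ∈ B)] (hB : MeasurableSet B) {c : ℝ}
    (hc : 0 < c) (hpB : Real.exp (3 / c) * D.real B ≤ 1) :
    (Measure.pi fun _ : Fin n => D).real
      {S | c * n ≤ ((Finset.univ.filter fun i => S i ∈ B).card : ℝ)} ≤ Real.exp (-2 * n) := by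
  set X : (Fin n → Pt d) → ℝ := fun S => ((Finset.univ.filter fun i => S i ∈ B).card : ℝ)
  have hX : ∀ S, Real.exp (3 / c * X S) =
      ∏ i, (1 + B.indicator (fun _ => Real.exp (3 / c) - 1) (S i)) := by
    intro S
    have : ∀ i, (1 + B.indicator (fun _ => Real.exp (3 / c) - 1) (S i)) =
        if S i ∈ B then Real.exp (3 / c) else 1 := by
      intro i
      by_cases hi : S i ∈ B <;> simp [hi]
    simp only [this]
    rw [Finset.prod_ite]
    simp only [Finset.prod_const, one_pow, mul_one, X]
    rw [mul_comm, Real.exp_nat_mul]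
  have hI : Integrable (fun z => 1 + B.indicator (fun _ => Real.exp (3 / c) - 1) z) D :=
    (integrable_const _).add ((integrable_const _).indicator hB)
  have h1 := ProbabilityTheory.measure_ge_le_exp_mul_mgf
    (μ := Measure.pi fun _ : Fin n => D) (X := X) (t := 3 / c) (c * n) (by positivity) (by
      simp only [hX]
      exact Integrable.fintype_prod
        (f := fun _ z => 1 + B.indicator (fun _ => Real.exp (3 / c) - 1) z) fun _ => hI)
  refine h1.trans ?_
  rw [ProbabilityTheory.mgf]
  simp only [hX]
  rw [integral_fintype_prod_eq_pow
    (fun z => 1 + B.indicator (fun _ => Real.exp (3 / c) - 1) z), Fintype.card_fin]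
  have h2 : ∫ z, (1 + B.indicator (fun _ => Real.exp (3 / c) - 1) z) ∂D =
      1 + D.real B * (Real.exp (3 / c) - 1) := by
    rw [integral_add (integrable_const _) ((integrable_const _).indicator hB),
      integral_indicator_const _ hB]
    simp
  have h3 : 1 ≤ Real.exp (3 / c) := Real.one_le_exp (by positivity)
  have h4 := measureReal_nonneg (μ := D) (s := B)
  rw [h2]
  calc Real.exp (-(3 / c) * (c * n)) * (1 + D.real B * (Real.exp (3 / c) - 1)) ^ n
      ≤ Real.exp (-(3 / c) * (c * n)) * Real.exp 1 ^ n := by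
        have h5 : 0 ≤ D.real B * (Real.exp (3 / c) - 1) := mul_nonneg h4 (by linarith)
        gcongr
        linarith [Real.add_one_le_exp 1]
    _ = Real.exp (-2 * n) := by
        rw [← Real.exp_nat_mul, ← Real.exp_add]
        congr 1
        field_simp
        ring

end Sample

/-! ### The good event, and alignment of the run on it. -/

section Event

variable {d n : ℕ} {ν : Measure ℝ} [IsProbabilityMeasure ν] {μ : Fin d → ℝ}
  {D : Measure (Pt d)}

/-- A sample of typical, pairwise nearly orthogonal points, most of which are correctly labelled. -/
def IsGoodSample (κ s c : ℝ) (μ : Fin d → ℝ) (S : Fin n → Pt d) : Prop :=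
  (∀ i, IsTypical κ μ (S i).1) ∧
    (∀ i j, i ≠ j → |(S i).1 ⬝ᵥ (S j).1| ≤ s * d / n) ∧
    ((Finset.univ.filter fun i => μ ⬝ᵥ signed (S i) < μ ⬝ᵥ μ / 2).card : ℝ) ≤ c * n

theorem measurableSet_typical_pair (κ b : ℝ) (μ : Fin d → ℝ) :
    MeasurableSet {w : Pt d × Pt d | IsTypical κ μ w.1.1 ∧ b < |w.1.1 ⬝ᵥ w.2.1|} := by
  have h1 : Measurable fun w : Pt d × Pt d => w.1.1 ⬝ᵥ w.2.1 := by
    unfold dotProduct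
    fun_prop
  have h2 : Measurable fun w : Pt d × Pt d => w.1.1 := by fun_prop
  exact (h2 (measurableSet_isTypical κ μ)).inter (measurableSet_lt measurable_const h1.abs)

theorem sq_mul_exp_neg_log_le {δ : ℝ} (hn : 2 ≤ n) (hδ0 : 0 < δ) (hδ1 : δ < 1) :
    (n : ℝ) ^ 2 * Real.exp (-(8 * Real.log (n / δ))) ≤ δ / 64 := by
  have hn2 : (2 : ℝ) ≤ n := by exact_mod_cast hn
  have hn0 : (0 : ℝ) < n := by linarith
  have h1 : Real.exp (-(8 * Real.log (n / δ))) = (δ / n) ^ 8 := by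
    have hy : Real.exp (-Real.log (n / δ)) = δ / n := by
      rw [Real.exp_neg, Real.exp_log (by positivity), inv_div]
    rw [← hy, ← Real.exp_nat_mul]
    congr 1
    push_cast
    ring
  have h2 : δ / n ≤ 1 / 2 := by
    rw [div_le_div_iff₀ hn0 (by norm_num)]
    linarith
  have h4 : (n : ℝ) ^ 2 * (δ / n) ^ 8 = δ * (δ * (δ / n) ^ 6) := by field_simp
  rw [h1, h4]
  have h5 : δ * (δ / n) ^ 6 ≤ 1 * (1 / 2) ^ 6 := by gcongr
  calc δ * (δ * (δ / n) ^ 6) ≤ δ * (1 * (1 / 2) ^ 6) := by gcongr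
    _ = δ / 64 := by ring

theorem exp_neg_two_mul_le {δ : ℝ} (hn : 1 ≤ n) (hδ0 : 0 < δ) (hnδ : Real.log (1 / δ) ≤ n) :
    Real.exp (-2 * n) ≤ δ / 2 := by
  have hn1 : (1 : ℝ) ≤ n := by exact_mod_cast hn
  have h1 : Real.exp (-n) ≤ δ := by
    rw [one_div, Real.log_inv] at hnδ
    calc Real.exp (-n) ≤ Real.exp (Real.log δ) := Real.exp_le_exp.2 (by linarith)
      _ = δ := Real.exp_log hδ0
  have h4 : Real.exp (-n) ≤ 1 / 2 := by
    rw [Real.exp_neg, one_div]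
    refine inv_anti₀ (by norm_num) ?_
    linarith [Real.add_one_le_exp (n : ℝ)]
  calc Real.exp (-2 * n) = Real.exp (-n) * Real.exp (-n) := by
        rw [← Real.exp_add]
        congr 1
        ring
    _ ≤ δ * (1 / 2) := by gcongr
    _ = δ / 2 := by ring

theorem real_not_isTypical_le (hν : subGaussianNorm ν ≤ 1) (hmean : ∫ x, x ∂ν = 0) {η : ℝ}
    (hD : IsNoisyVersion D (cleanLaw ν μ) η) {κ C l : ℝ} (hκ0 : 0 < κ)
    (hκ : κ ≤ ∫ x, x ^ 2 ∂ν) (hl : 0 ≤ l) (hμd : μ ⬝ᵥ μ ≤ d)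
    (hC1 : 2000 ≤ C) (hC2 : 1024 / κ ^ 2 ≤ C) (hCd : C * l ≤ d) (hCμ : C * l ≤ μ ⬝ᵥ μ) :
    D.real (Prod.fst ⁻¹' {x | IsTypical κ μ x}ᶜ) ≤ 4 * Real.exp (-(8 * l)) := by
  rw [real_preimage_fst_eq hD (measurableSet_isTypical κ μ).compl]
  refine (cleanLaw_not_isTypical_le hν hmean hκ0.le hκ hμd).trans ?_
  have h0 : 2000 * l ≤ C * l := by gcongr
  have h1 : Real.exp (-2 * d) ≤ Real.exp (-(8 * l)) := Real.exp_le_exp.2 (by linarith)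
  have h2 : Real.exp (-(κ ^ 2 / 128 * d)) ≤ Real.exp (-(8 * l)) := by
    refine Real.exp_le_exp.2 (neg_le_neg ?_)
    have h3 : 1024 ≤ C * κ ^ 2 := by rwa [div_le_iff₀ (by positivity)] at hC2
    have h4 : κ ^ 2 * (C * l) ≤ κ ^ 2 * d := by gcongr
    have h5 : 1024 * l ≤ C * κ ^ 2 * l := by gcongr
    linarith
  have h3 : Real.exp (-(μ ⬝ᵥ μ / 240)) ≤ Real.exp (-(8 * l)) :=
    Real.exp_le_exp.2 (neg_le_neg (by linarith))
  linarith

theorem real_abs_dotProduct_typical_le (hν : subGaussianNorm ν ≤ 1) (hmean : ∫ x, x ∂ν = 0)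
    {η : ℝ} (hD : IsNoisyVersion D (cleanLaw ν μ) η) {κ s C l : ℝ} (hκ0 : 0 < κ) (hs : 0 < s)
    (hl : 0 ≤ l) (hn : 0 < n) (hd : 0 < d) (hC3 : 192000 / s ^ 2 ≤ C) (hC5 : 3 / s ≤ C)
    (hdμ : C * (n * (μ ⬝ᵥ μ)) ≤ d) (hdn : C * ((n : ℝ) ^ 2 * l) ≤ d) {v : Fin d → ℝ}
    (hv : IsTypical κ μ v) :
    D.real (Prod.fst ⁻¹' {x | s * d / n < |v ⬝ᵥ x|}) ≤ 2 * Real.exp (-(8 * l)) := by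
  have hn0 : (0 : ℝ) < n := by exact_mod_cast hn
  have hd0 : (0 : ℝ) < d := by exact_mod_cast hd
  have hμ0 : 0 ≤ μ ⬝ᵥ μ := by
    rw [← vecNorm_two_sq]
    positivity
  rw [real_preimage_fst_eq hD
    (measurableSet_lt measurable_const (measurable_dotProduct_left v).abs)]
  refine (cleanLaw_abs_dotProduct_ge_le hν hmean (by positivity) ?_
    (lt_of_lt_of_le (by positivity) hv.1) hv.2.1).trans ?_
  -- The mean part: typicality gives `|v ⬝ᵥ μ| ≤ 3 / 2 * ‖μ‖₂²`, which `C * s ≥ 3` and `C * n *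
  -- ‖μ‖₂² ≤ d` bring below half the threshold.
  · rw [dotProduct_comm]
    refine hv.2.2.trans ?_
    rw [div_div, le_div_iff₀ (by positivity)]
    have h3 : 3 ≤ C * s := by rwa [div_le_iff₀ hs] at hC5
    have h4 : s * (C * (n * (μ ⬝ᵥ μ))) ≤ s * d := by gcongr
    have h5 : 3 * (n * (μ ⬝ᵥ μ)) ≤ C * s * (n * (μ ⬝ᵥ μ)) := by gcongr
    linarith
  · refine mul_le_mul_of_nonneg_left (Real.exp_le_exp.2 (neg_le_neg ?_)) (by norm_num)
    rw [show (s * d / n) ^ 2 / (24000 * d) = s ^ 2 * d / (24000 * n ^ 2) by field_simp,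
      le_div_iff₀ (by positivity)]
    have h3 : 192000 ≤ C * s ^ 2 := by rwa [div_le_iff₀ (by positivity)] at hC3
    have h4 : s ^ 2 * (C * ((n : ℝ) ^ 2 * l)) ≤ s ^ 2 * d := by gcongr
    have h5 : 192000 * ((n : ℝ) ^ 2 * l) ≤ C * s ^ 2 * ((n : ℝ) ^ 2 * l) := by gcongr
    linarith

variable [IsProbabilityMeasure D]

/-- The noise level contributes `1 / C`, and the clean tail `exp (-‖μ‖₂² / 240) ≤ 240 / ‖μ‖₂² ≤ 480
/ C`. -/
theorem real_misaligned_le (hν : subGaussianNorm ν ≤ 1) (hmean : ∫ x, x ∂ν = 0) {η : ℝ}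
    (hD : IsNoisyVersion D (cleanLaw ν μ) η) {C : ℝ} (hC0 : 0 < C) (hη : η < 1 / C)
    (hCμ : C / 2 ≤ μ ⬝ᵥ μ) :
    D.real {z | μ ⬝ᵥ signed z < μ ⬝ᵥ μ / 2} ≤ 481 / C := by
  have hμ0 : 0 < μ ⬝ᵥ μ := by linarith
  have h1 := real_le_of_tvDist_le hD.2
    (measurableSet_lt (measurable_dotProduct_signed μ) (measurable_const (a := μ ⬝ᵥ μ / 2)))
  have h2 := cleanLaw_dotProduct_signed_le hν hmean μ (μ := μ) (b := μ ⬝ᵥ μ / 2)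
    (m := μ ⬝ᵥ μ / 2) (by linarith) (by linarith)
  have h3 : -(μ ⬝ᵥ μ / 2) ^ 2 / (60 * (μ ⬝ᵥ μ)) = -(μ ⬝ᵥ μ / 240) := by
    field_simp
    ring
  rw [h3] at h2
  have h4 : (cleanLaw ν μ).real {z | μ ⬝ᵥ signed z < μ ⬝ᵥ μ / 2} ≤
      (cleanLaw ν μ).real {z | μ ⬝ᵥ signed z ≤ μ ⬝ᵥ μ / 2} :=
    measureReal_mono fun z (hz : μ ⬝ᵥ signed z < μ ⬝ᵥ μ / 2) => hz.le
  have h5 : Real.exp (-(μ ⬝ᵥ μ / 240)) ≤ 480 / C := by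
    rw [Real.exp_neg, inv_le_comm₀ (Real.exp_pos _) (by positivity), inv_div]
    linarith [Real.add_one_le_exp (μ ⬝ᵥ μ / 240)]
  have h6 : 481 / C = 480 / C + 1 / C := by ring
  linarith

theorem pi_not_isGoodSample_le (hν : subGaussianNorm ν ≤ 1) (hmean : ∫ x, x ∂ν = 0) {η : ℝ}
    (hD : IsNoisyVersion D (cleanLaw ν μ) η) {κ s c C δ : ℝ} (hκ0 : 0 < κ)
    (hκ : κ ≤ ∫ x, x ^ 2 ∂ν) (hs : 0 < s) (hc : 0 < c)
    (hC1 : 2000 ≤ C) (hC2 : 1024 / κ ^ 2 ≤ C) (hC3 : 192000 / s ^ 2 ≤ C)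
    (hC4 : 481 * Real.exp (3 / c) ≤ C) (hC5 : 3 / s ≤ C) (hn : 2 ≤ n) (hδ0 : 0 < δ) (hδ1 : δ < 1)
    (hnδ : C * Real.log (1 / δ) ≤ n) (hdμ : C * (n * (μ ⬝ᵥ μ)) ≤ d)
    (hdn : C * ((n : ℝ) ^ 2 * Real.log (n / δ)) ≤ d) (hη : η < 1 / C)
    (hμL : C * Real.log (n / δ) ≤ μ ⬝ᵥ μ) :
    (Measure.pi fun _ : Fin n => D).real {S | ¬ IsGoodSample κ s c μ S} ≤ δ := by
  have hC0 : 0 < C := by linarith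
  have hn2 : (2 : ℝ) ≤ n := by exact_mod_cast hn
  have hn0 : (0 : ℝ) < n := by linarith
  have hXle := sq_mul_exp_neg_log_le hn hδ0 hδ1
  set l := Real.log (n / δ) with hl
  have hl2 : 1 / 2 ≤ l := by
    have h1 : Real.log 2 ≤ l := by
      refine Real.log_le_log (by norm_num) ?_
      rw [le_div_iff₀ hδ0]
      linarith
    linarith [Real.log_two_gt_d9]
  have hl0 : 0 ≤ l := by linarith
  have hCl : C * l ≤ d := by
    refine le_trans (mul_le_mul_of_nonneg_left ?_ hC0.le) hdn
    exact le_mul_of_one_le_left hl0 (one_le_pow₀ (by linarith))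
  have hd0 : (0 : ℝ) < d := lt_of_lt_of_le (by positivity) hCl
  have hd : 0 < d := by exact_mod_cast hd0
  have hμ0 : 0 < μ ⬝ᵥ μ := lt_of_lt_of_le (by positivity) hμL
  have hμd : μ ⬝ᵥ μ ≤ d := by
    refine le_trans ?_ hdμ
    rw [← mul_assoc]
    exact le_mul_of_one_le_left hμ0.le (one_le_mul_of_one_le_of_one_le (by linarith)
      (by linarith))
  set X := Real.exp (-(8 * l)) with hX
  have hX0 : 0 < X := Real.exp_pos _
  have htyp : ∀ i : Fin n, (Measure.pi fun _ : Fin n => D).real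
      {S | S i ∈ Prod.fst ⁻¹' {x | IsTypical κ μ x}ᶜ} ≤ 4 * X := by
    intro i
    rw [pi_real_eval i (measurable_fst (measurableSet_isTypical κ μ).compl)]
    exact real_not_isTypical_le hν hmean hD hκ0 hκ hl0 hμd hC1 hC2 hCl hμL
  set A : Set (Pt d × Pt d) := {w | IsTypical κ μ w.1.1 ∧ s * d / n < |w.1.1 ⬝ᵥ w.2.1|} with hA
  -- Atypicality of the first point is counted in `htyp`, so the pair event may assume it typical.
  have hpair : ∀ w : Fin n × Fin n, (Measure.pi fun _ : Fin n => D).real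
      {S | w.1 ≠ w.2 ∧ (S w.1, S w.2) ∈ A} ≤ 2 * X := by
    rintro ⟨i, j⟩
    by_cases hij : i = j
    · simp [hij, hX0.le]
    simp only [ne_eq, hij, not_false_eq_true, true_and]
    refine pi_real_pair_le hij (measurableSet_typical_pair κ _ μ) (by positivity) fun z => ?_
    by_cases hz : IsTypical κ μ z.1
    · have hsub : {z' : Pt d | (z, z') ∈ A} = Prod.fst ⁻¹' {x | s * d / n < |z.1 ⬝ᵥ x|} := by
        ext z'
        simp [hA, hz]
      rw [hsub]
      exact real_abs_dotProduct_typical_le hν hmean hD hκ0 hs hl0 (by omega) hd hC3 hC5 hdμ hdn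
        hz
    · have hempty : {z' : Pt d | (z, z') ∈ A} = ∅ := by
        ext z'
        simp [hA, hz]
      rw [hempty, measureReal_empty]
      positivity
  classical
  set B : Set (Pt d) := {z | μ ⬝ᵥ signed z < μ ⬝ᵥ μ / 2} with hB
  have hcount : (Measure.pi fun _ : Fin n => D).real
      {S | c * n ≤ ((Finset.univ.filter fun i => S i ∈ B).card : ℝ)} ≤ Real.exp (-2 * n) := by
    refine pi_real_count_le
      (measurableSet_lt (measurable_dotProduct_signed μ) measurable_const) hc ?_
    have h7 : D.real B ≤ 481 / C := by
      refine real_misaligned_le hν hmean hD hC0 hη (le_trans ?_ hμL)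
      have := mul_le_mul_of_nonneg_left hl2 hC0.le
      linarith
    calc Real.exp (3 / c) * D.real B ≤ Real.exp (3 / c) * (481 / C) := by gcongr
      _ = 481 * Real.exp (3 / c) / C := by ring
      _ ≤ 1 := (div_le_one hC0).2 hC4
  have hexpn : Real.exp (-2 * n) ≤ δ / 2 := by
    refine exp_neg_two_mul_le (by omega) hδ0 (le_trans ?_ hnδ)
    exact le_mul_of_one_le_left (Real.log_nonneg ((one_le_div hδ0).2 hδ1.le)) (by linarith)
  have hsub : {S : Fin n → Pt d | ¬ IsGoodSample κ s c μ S} ⊆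
      ((⋃ i : Fin n, {S | S i ∈ Prod.fst ⁻¹' {x | IsTypical κ μ x}ᶜ}) ∪
        ⋃ w : Fin n × Fin n, {S | w.1 ≠ w.2 ∧ (S w.1, S w.2) ∈ A}) ∪
        {S | c * n ≤ ((Finset.univ.filter fun i => S i ∈ B).card : ℝ)} := by
    intro S hS
    by_contra hcon
    rw [Set.mem_union, Set.mem_union, not_or, not_or] at hcon
    obtain ⟨⟨h1, h2⟩, h3⟩ := hcon
    have hty : ∀ i, IsTypical κ μ (S i).1 := by
      intro i
      by_contra hi
      exact h1 (Set.mem_iUnion.2 ⟨i, hi⟩)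
    refine hS ⟨hty, fun i j hij => ?_, ?_⟩
    · by_contra! hlt
      exact h2 (Set.mem_iUnion.2 ⟨(i, j), hij, hty i, hlt⟩)
    · refine (lt_of_not_ge fun hge => h3 ?_).le
      have heq : (Finset.univ.filter fun i => S i ∈ B) =
          Finset.univ.filter fun i => μ ⬝ᵥ signed (S i) < μ ⬝ᵥ μ / 2 := by
        ext i
        simp [hB]
      rw [Set.mem_ofPred_eq, heq]
      exact hge
  have hU1 := measureReal_iUnion_fintype_le (μ := Measure.pi fun _ : Fin n => D)
    fun i : Fin n => {S : Fin n → Pt d | S i ∈ Prod.fst ⁻¹' {x | IsTypical κ μ x}ᶜ}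
  have hU2 := measureReal_iUnion_fintype_le (μ := Measure.pi fun _ : Fin n => D)
    fun w : Fin n × Fin n => {S : Fin n → Pt d | w.1 ≠ w.2 ∧ (S w.1, S w.2) ∈ A}
  have hS1 := Finset.sum_le_card_nsmul Finset.univ _ (4 * X) fun i _ => htyp i
  have hS2 := Finset.sum_le_card_nsmul Finset.univ _ (2 * X) fun w _ => hpair w
  simp only [Finset.card_univ, Fintype.card_fin, Fintype.card_prod, nsmul_eq_mul,
    Nat.cast_mul] at hS1 hS2
  have hV := ((measureReal_mono (μ := Measure.pi fun _ : Fin n => D) hsub).trans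
    (measureReal_union_le _ _)).trans (add_le_add_left (measureReal_union_le _ _) _)
  -- The total failure probability is at most `6 * n ^ 2 * X + exp (-2 * n) ≤ 6 * δ / 64 + δ / 2 ≤
  -- δ`.
  have hnX : n * (4 * X) ≤ 4 * ((n : ℝ) ^ 2 * X) := by
    have h1 : (n : ℝ) * X ≤ (n : ℝ) ^ 2 * X := by
      gcongr
      exact le_self_pow₀ (by linarith) two_ne_zero
    linarith
  have hnX' : (n : ℝ) * n * (2 * X) = 2 * ((n : ℝ) ^ 2 * X) := by ring
  linarith

/-- For the case `n = 1`, where `log (n / δ)` may be close to `0` and the exponential tails give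
nothing. A fixed failure probability is enough there: `1 / 2 + 1 / 10 + 3 / 10`. -/
theorem pi_single_not_aligned_le (hν : subGaussianNorm ν ≤ 1) {η : ℝ}
    (hD : IsNoisyVersion D (cleanLaw ν μ) η) (hη : η ≤ 1 / 10) (hd : 0 < d)
    (hμd : μ ⬝ᵥ μ ≤ d) (i : Fin n) :
    (Measure.pi fun _ : Fin n => D).real
      {S | ¬ (μ ⬝ᵥ μ ≤ μ ⬝ᵥ signed (S i) ∧ (S i).1 ⬝ᵥ (S i).1 ≤ 100 * d)} ≤ 9 / 10 := by
  set A : Set (Pt d) := {z | μ ⬝ᵥ signed z < μ ⬝ᵥ μ} with hA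
  set B : Set (Pt d) := Prod.fst ⁻¹' {x | 100 * (d : ℝ) < x ⬝ᵥ x} with hB
  have hAm : MeasurableSet A :=
    measurableSet_lt (measurable_dotProduct_signed μ) measurable_const
  have hBm' : MeasurableSet {x : Fin d → ℝ | 100 * (d : ℝ) < x ⬝ᵥ x} :=
    measurableSet_lt measurable_const measurable_dotProduct_self
  have hsub : {S : Fin n → Pt d |
      ¬ (μ ⬝ᵥ μ ≤ μ ⬝ᵥ signed (S i) ∧ (S i).1 ⬝ᵥ (S i).1 ≤ 100 * d)} ⊆ {S | S i ∈ A ∪ B} := by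
    intro S hS
    rw [Set.mem_ofPred_eq, not_and_or, not_le, not_le] at hS
    exact hS
  refine (measureReal_mono hsub).trans ?_
  rw [pi_real_eval i (hAm.union (measurable_fst hBm'))]
  have h1 := measureReal_union_le (μ := D) A B
  have h2 := real_le_of_tvDist_le hD.2 hAm
  have h3 := cleanLaw_dotProduct_signed_lt_le_half (ν := ν) (μ := μ) μ
  have h4 := cleanLaw_dotProduct_self_gt_le hν hμd
  rw [← real_preimage_fst_eq hD hBm'] at h4
  have hd1 : (1 : ℝ) ≤ d := by exact_mod_cast hd
  have h5 : Real.exp (-2 * d) ≤ 3 / 10 := by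
    have h6 : Real.exp (-2 * d) ≤ Real.exp (-2) := Real.exp_le_exp.2 (by linarith)
    have h7 : Real.exp (-2) ≤ 3 / 10 := by
      rw [Real.exp_neg, inv_le_comm₀ (Real.exp_pos _) (by norm_num)]
      have := Real.quadratic_le_exp_of_nonneg (x := 2) (by norm_num)
      linarith
    exact h6.trans h7
  linarith

/-- The complement of a measurable hull of the failure set serves as event, so the property itself
need not be measurable. -/
theorem exists_event_of_real_le {Ω : Type*} [MeasurableSpace Ω] {P : Measure Ω}
    [IsProbabilityMeasure P] {p : Ω → Prop} {δ : ℝ} (h : P.real {ω | ¬ p ω} ≤ δ) :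
    ∃ E, MeasurableSet E ∧ 1 - δ ≤ P.real E ∧ ∀ ω ∈ E, p ω := by
  refine ⟨(toMeasurable P {ω | ¬ p ω})ᶜ, (measurableSet_toMeasurable _ _).compl, ?_, ?_⟩
  · rw [probReal_compl_eq_one_sub (measurableSet_toMeasurable _ _), measureReal_def,
      measure_toMeasurable, ← measureReal_def]
    linarith
  · intro ω hω
    by_contra hp
    exact hω (subset_toMeasurable P _ hp)

theorem signed_dotProduct_signed (z z' : Pt d) :
    signed z ⬝ᵥ signed z' = lab z.2 * (lab z'.2 * (z.1 ⬝ᵥ z'.1)) := by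
  rw [dotProduct_signed, dotProduct_comm, dotProduct_signed, dotProduct_comm]
  ring

theorem signed_dotProduct_self (z : Pt d) : signed z ⬝ᵥ signed z = z.1 ⬝ᵥ z.1 :=
  smul_lab_dotProduct_self z.1 z.2

/-- With high probability over the sample, adversarial training yields parameters that are
aligned with `μ`. -/
theorem exists_event_run_aligned (hν : subGaussianNorm ν ≤ 1) (hmean : ∫ x, x ∂ν = 0) {η : ℝ}
    (hD : IsNoisyVersion D (cleanLaw ν μ) η) {κ s c C δ ε : ℝ} {p q : ℝ≥0∞} (hp : 1 ≤ p)
    (hpt : p ≠ ⊤) (hpq : p⁻¹ + q⁻¹ = 1) (hε : 0 ≤ ε) (hκ0 : 0 < κ) (hκ1 : κ ≤ 1)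
    (hκ : κ * d ≤ ∫ ξ, vecNorm 2 ξ ^ 2 ∂(noiseLaw d ν)) (hs : s = κ ^ 2 / 12800)
    (hc : c = κ / 12800)
    (hC1 : 2000 ≤ C) (hC2 : 1024 / κ ^ 2 ≤ C) (hC3 : 192000 / s ^ 2 ≤ C)
    (hC4 : 481 * Real.exp (3 / c) ≤ C) (hC5 : 3 / s ≤ C) (hδ0 : 0 < δ) (hδ1 : δ < 1)
    (hnδ : C * Real.log (1 / δ) ≤ n) (hdμ : C * (n * (μ ⬝ᵥ μ)) ≤ d)
    (hdn : C * ((n : ℝ) ^ 2 * Real.log (n / δ)) ≤ d) (hη : η < 1 / C)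
    (hμL : C * Real.log (n / δ) ≤ μ ⬝ᵥ μ) (hεμ : C * (ε * vecNorm q μ) ≤ μ ⬝ᵥ μ) :
    0 < n ∧ 0 < d ∧ ∃ E : Set (Fin n → Pt d), MeasurableSet E ∧
      1 - δ ≤ (Measure.pi fun _ : Fin n => D).real E ∧
      ∀ S ∈ E, ∀ r : ℝ, 0 ≤ r → (∀ v : Fin d → ℝ, ε * vecNorm q v ≤ r * vecNorm 2 v) →
        r * (100 * Real.sqrt d) ≤ μ ⬝ᵥ μ →
        ∀ (α : ℕ → ℝ) (θ : ℕ → Fin d → ℝ), (∀ t, 0 < α t) → (∀ t, α t * d * 202 ≤ 1) →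
          IsAdvTrainingRun p ε S α θ → ∀ t ≥ 1,
            0 < θ t ⬝ᵥ μ ∧ μ ⬝ᵥ μ * vecNorm 2 (θ t) ≤ 88 * Real.sqrt d * (θ t ⬝ᵥ μ) := by
  have hC0 : 0 < C := by linarith
  have hlδ : 0 < Real.log (1 / δ) := Real.log_pos ((one_lt_div hδ0).2 hδ1)
  have hn0 : (0 : ℝ) < n := lt_of_lt_of_le (by positivity) hnδ
  have hn : 0 < n := by exact_mod_cast hn0
  have hn1 : (1 : ℝ) ≤ n := by exact_mod_cast hn
  have hl0 : 0 < Real.log (n / δ) := Real.log_pos ((one_lt_div hδ0).2 (by linarith))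
  have hd0 : (0 : ℝ) < d := lt_of_lt_of_le (by positivity) hdn
  have hd : 0 < d := by exact_mod_cast hd0
  have hμ0 : 0 < μ ⬝ᵥ μ := lt_of_lt_of_le (by positivity) hμL
  have hs0 : 0 < s := by
    rw [hs]
    positivity
  have hc0 : 0 < c := by
    rw [hc]
    positivity
  have hsq0 : 0 < Real.sqrt d := Real.sqrt_pos.2 hd0
  have hsq : Real.sqrt d * Real.sqrt d = d := Real.mul_self_sqrt hd0.le
  have hεμ8 : 8 * (ε * vecNorm q μ) ≤ μ ⬝ᵥ μ := by
    refine le_trans ?_ hεμ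
    have := mul_nonneg hε (vecNorm_nonneg q (one_le_of_conj hpq) μ)
    gcongr
    linarith
  -- Combined with `C * n * ‖μ‖₂² ≤ d` the hypothesis gives `r * n ≤ √d / (100 * C)`, and `1 / C ≤ s
  -- / 3`.
  have hrn : ∀ r : ℝ, r * (100 * Real.sqrt d) ≤ μ ⬝ᵥ μ → r * n * 10 ≤ s * Real.sqrt d := by
    intro r hr
    have h3 : 3 ≤ C * s := by rwa [div_le_iff₀ hs0] at hC5
    have h1 : C * n * (r * (100 * Real.sqrt d)) ≤ C * n * (μ ⬝ᵥ μ) := by gcongr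
    have h2 : (C * (100 * r * n)) * Real.sqrt d ≤ Real.sqrt d * Real.sqrt d := by
      rw [hsq]
      linarith
    have h4 := le_of_mul_le_mul_right h2 hsq0
    have h5 : 3 * Real.sqrt d ≤ C * s * Real.sqrt d := by gcongr
    have h6 : C * (r * n * 10) ≤ C * (s * Real.sqrt d) := by linarith
    exact le_of_mul_le_mul_left h6 hC0
  have hrd : ∀ r : ℝ, r * (100 * Real.sqrt d) ≤ μ ⬝ᵥ μ → r ≤ Real.sqrt d := by
    intro r hr
    have h1 : μ ⬝ᵥ μ ≤ d := by
      refine le_trans ?_ hdμ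
      rw [← mul_assoc]
      refine le_mul_of_one_le_left hμ0.le ?_
      nlinarith
    have h2 : (100 * r) * Real.sqrt d ≤ Real.sqrt d * Real.sqrt d := by
      rw [hsq]
      linarith
    have h3 := le_of_mul_le_mul_right h2 hsq0
    linarith
  refine ⟨hn, hd, ?_⟩
  rcases Nat.lt_or_ge 1 n with hn2 | hn2
  · obtain ⟨E, hE, hPE, hgood⟩ := exists_event_of_real_le (pi_not_isGoodSample_le hν hmean hD hκ0
      (le_variance_of_le_integral_vecNorm_sq hν hd hκ) hs0 hc0 hC1 hC2 hC3 hC4 hC5 hn2 hδ0 hδ1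
      hnδ hdμ hdn hη hμL)
    refine ⟨E, hE, hPE, fun S hS r hr hrq hrμ α θ hα hαd hrun t ht => ?_⟩
    obtain ⟨hty, hcross, hbad⟩ := hgood S hS
    -- With `a = κ / 2` the condition `A * a = 800` forces `A = 1600 / κ`; the values of `s` and `c`
    -- make `4 * s * A = a` and `8 * c * A = 1`.
    have hratio : ∀ t i j, advWeight p ε (S i) (θ t) ≤
        1600 / κ * advWeight p ε (S j) (θ t) := by
      refine weights_comparable hp hpt hpq hε (a := κ / 2) hr hrq hrun hn hd (by positivity)
        (by linarith) (by field_simp; norm_num) hs0.le (le_of_eq ?_) (fun t => (hα t).le) hαd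
        (fun i => ?_) (fun i => ?_) (fun i j hij => ?_) (hrn r hrμ)
      · rw [hs]
        field_simp
        norm_num
      · rw [signed_dotProduct_self]
        exact (hty i).1
      · rw [signed_dotProduct_self]
        exact (hty i).2.1
      · rw [signed_dotProduct_signed, abs_lab_mul, abs_lab_mul]
        exact hcross i j hij
    refine run_aligned hp hpt hpq hε hr hrq hrun hn (by positivity) hα hratio hμ0 hεμ8
      (fun i => ?_) hbad (le_of_eq ?_) (fun i => ?_) (hrd r hrμ) t ht
    · have h1 := (hty i).2.2
      rw [← abs_lab_mul (S i).2, ← dotProduct_signed] at h1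
      exact (abs_le.1 h1).1
    · rw [hc]
      field_simp
      norm_num
    · refine vecNorm_two_le_of_dotProduct_self_le ?_
      rw [signed_dotProduct_self]
      exact (hty i).2.1
  · have hn1' : n = 1 := le_antisymm hn2 hn
    subst hn1'
    have hμd : μ ⬝ᵥ μ ≤ d := by
      refine le_trans ?_ hdμ
      rw [← mul_assoc]
      refine le_mul_of_one_le_left hμ0.le ?_
      nlinarith
    have hη' : η ≤ 1 / 10 := hη.le.trans (one_div_le_one_div_of_le (by norm_num) (by linarith))
    -- With one sample point, `C * log (1 / δ) ≤ 1` pushes `δ` close to `1`.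
    have hδ9 : 9 / 10 ≤ δ := by
      rw [one_div, Real.log_inv, Nat.cast_one] at hnδ
      have h1 : -(1 / 10) ≤ Real.log δ := by
        by_contra! hlt
        nlinarith
      have h2 := Real.add_one_le_exp (Real.log δ)
      rw [Real.exp_log hδ0] at h2
      linarith
    obtain ⟨E, hE, hPE, hgood⟩ := exists_event_of_real_le
      ((pi_single_not_aligned_le hν hD hη' hd hμd (0 : Fin 1)).trans hδ9)
    refine ⟨E, hE, hPE, fun S hS r hr hrq hrμ α θ hα hαd hrun t ht => ?_⟩
    obtain ⟨h1, h2⟩ := hgood S hS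
    have hall : ∀ i : Fin 1, i = 0 := fun i => Subsingleton.elim _ _
    refine run_aligned hp hpt hpq hε hr hrq hrun hn (A := 1) (c := 0) zero_le_one hα
      (fun t i j => ?_) hμ0 hεμ8 (fun i => ?_) ?_ (by norm_num) (fun i => ?_) (hrd r hrμ) t ht
    · rw [hall i, hall j, one_mul]
    · rw [hall i]
      linarith
    · rw [Finset.filter_false_of_mem]
      · simp
      · intro i _
        rw [hall i]
        linarith
    · refine vecNorm_two_le_of_dotProduct_self_le ?_
      rw [signed_dotProduct_self, hall i]
      exact h2

/-- The logarithmic term, `4 ε ‖μ‖_q` and the `ε` in the denominator only lower the gap, so all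
three can be dropped. -/
theorem gap_add_le {q : ℝ≥0∞} (hq : 1 ≤ q) {ε : ℝ} (hε : 0 ≤ ε) (hd : 0 < d) (μ : Fin d → ℝ)
    (n t : ℕ) (ρ : ℝ) : (gap 100 1 q ε μ n t ρ + ρ) * (100 * Real.sqrt d) ≤ μ ⬝ᵥ μ := by
  have hd0 : (0 : ℝ) < d := by exact_mod_cast hd
  have hsq0 : 0 < Real.sqrt d := Real.sqrt_pos.2 hd0
  have h1 : 0 ≤ 1 * vecNorm 2 μ * Real.log n / Real.log t := by
    have := vecNorm_nonneg 2 (by norm_num) μ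
    have := Real.log_natCast_nonneg n
    have := Real.log_natCast_nonneg t
    positivity
  have hq0 := mul_nonneg hε (vecNorm_nonneg q hq μ)
  have hμ0 : 0 ≤ μ ⬝ᵥ μ := by
    rw [← vecNorm_two_sq]
    positivity
  have h2 : gap 100 1 q ε μ n t ρ + ρ ≤ μ ⬝ᵥ μ / (100 * Real.sqrt d) := by
    have h3 : (vecNorm 2 μ ^ 2 - 4 * ε * vecNorm q μ) / ((100 + ε) * Real.sqrt d) ≤
        μ ⬝ᵥ μ / (100 * Real.sqrt d) := by
      rw [vecNorm_two_sq]
      gcongr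
      · linarith
      · linarith
    unfold gap
    linarith
  rwa [le_div_iff₀ (by positivity)] at h2

theorem stepSize_pos (hn : 0 < n) (hd : 0 < d) {G α : ℝ} (hG : 0 < G) (hα : 0 < α) (t : ℕ) :
    0 < stepSize d n G α t := by
  have hn0 : (0 : ℝ) < n := by exact_mod_cast hn
  have hd0 : (0 : ℝ) < d := by exact_mod_cast hd
  unfold stepSize
  split_ifs <;> positivity

theorem stepSize_mul_le (hn : 0 < n) (hd : 0 < d) {G α M : ℝ} (hG : 202 ≤ G) (hM : 1 ≤ M)
    (hα : α ≤ 1 / (G * d * n * M)) (t : ℕ) : stepSize d n G α t * d * 202 ≤ 1 := by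
  have hn1 : (1 : ℝ) ≤ n := by exact_mod_cast hn
  have hd0 : (0 : ℝ) < d := by exact_mod_cast hd
  have h1 : stepSize d n G α t ≤ 1 / (202 * d) := by
    have h2 : 1 / (G * d * n) ≤ 1 / (202 * d) := by
      refine one_div_le_one_div_of_le (by positivity) ?_
      calc 202 * (d : ℝ) ≤ G * d := by gcongr
        _ ≤ G * d * n := le_mul_of_one_le_right (by positivity) hn1
    have h3 : 1 / (G * d * n * M) ≤ 1 / (G * d * n) :=
      one_div_le_one_div_of_le (by positivity) (le_mul_of_one_le_right (by positivity) hM)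
    unfold stepSize
    split_ifs
    · exact h2
    · exact hα.trans (h3.trans h2)
  rw [le_div_iff₀ (by positivity)] at h1
  linarith

end Event

end AdvTraining

/-! ### Choice of constants and conclusion. -/

theorem theorem2 :
    -- absolute constants: `C'`, `C''`, `C'''` and the threshold `T` for `t`
    ∃ C₁ > (0 : ℝ), ∃ C₂ > (0 : ℝ), ∃ C₃ > (0 : ℝ), ∃ T : ℕ,
    ∀ κ : ℝ, 0 < κ → κ ≤ 1 → ∀ R > (0 : ℝ),
    ∃ C > (0 : ℝ), ∃ G₀ > (0 : ℝ), ∀ G ≥ G₀,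
    ∀ (p q : ℝ≥0∞), 1 ≤ p → p ≠ ⊤ → p⁻¹ + q⁻¹ = 1 →
    ∀ (n d : ℕ) (μ : Fin d → ℝ) (ε η δ : ℝ)
      (ν : Measure ℝ) (D : Measure (AdvTraining.Pt d)),
      -- the data model
      IsProbabilityMeasure ν → ∫ x, x ∂ν = 0 → AdvTraining.subGaussianNorm ν ≤ 1 →
      IsProbabilityMeasure D →
      AdvTraining.IsNoisyVersion D (AdvTraining.cleanLaw ν μ) η →
      κ * d ≤ ∫ ξ, AdvTraining.vecNorm 2 ξ ^ 2 ∂(AdvTraining.noiseLaw d ν) →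
      -- the parameters
      0 ≤ ε → ε ≤ R → 0 < δ → δ < 1 →
      C * Real.log (1 / δ) ≤ n →
      C * max (n * AdvTraining.vecNorm 2 μ ^ 2) ((n : ℝ) ^ 2 * Real.log (n / δ)) ≤ d →
      η < 1 / C →
      C * max (Real.log (n / δ)) (ε * AdvTraining.vecNorm q μ) ≤ AdvTraining.vecNorm 2 μ ^ 2 →
      -- with probability at least `1 - δ` over the training sample
      ∃ E : Set (Fin n → AdvTraining.Pt d), MeasurableSet E ∧
        1 - δ ≤ (Measure.pi fun _ : Fin n => D).real E ∧
        ∀ S ∈ E, ε < AdvTraining.stdMargin q S →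
          ∀ α > (0 : ℝ),
            α ≤ 1 / (G * d * n *
              AdvTraining.stepM q d ε (AdvTraining.advMargin p ε S) G) →
          ∀ θ : ℕ → Fin d → ℝ,
            AdvTraining.IsAdvTrainingRun p ε S (AdvTraining.stepSize d n G α) θ →
          ∀ t ≥ T,
            (p ≤ 2 →
              0 ≤ AdvTraining.gap C₂ C₃ q ε μ n t ε →
              AdvTraining.advRisk D p ε (θ t) ≤
                η + Real.exp (-C₁ * AdvTraining.gap C₂ C₃ q ε μ n t ε ^ 2)) ∧
            (2 < p →
              0 ≤ AdvTraining.gap C₂ C₃ q ε μ n t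
                (ε * (d : ℝ) ^ (1 / q.toReal - 1 / 2)) →
              AdvTraining.advRisk D p ε (θ t) ≤
                η + Real.exp (-C₁ * AdvTraining.gap C₂ C₃ q ε μ n t
                  (ε * (d : ℝ) ^ (1 / q.toReal - 1 / 2)) ^ 2)) := by
  -- `1 / 60` is the sub-Gaussian tail exponent and `100` exceeds the alignment constant `88`. Any
  -- positive `C₃` would do, as its term is subtracted. Alignment holds from `t = 1` on; `T = 2`
  -- keeps `log t` positive.
  refine ⟨1 / 60, by norm_num, 100, by norm_num, 1, by norm_num, 2, fun κ hκ0 hκ1 R _ => ?_⟩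
  set s : ℝ := κ ^ 2 / 12800 with hs
  set c : ℝ := κ / 12800 with hc
  have hs0 : 0 < s := by positivity
  set C : ℝ := 2000 + 1024 / κ ^ 2 + 192000 / s ^ 2 + 481 * Real.exp (3 / c) + 3 / s with hC
  have e1 : 0 < 1024 / κ ^ 2 := by positivity
  have e2 : 0 < 192000 / s ^ 2 := by positivity
  have e3 : 0 < 481 * Real.exp (3 / c) := by positivity
  have e4 : 0 < 3 / s := by positivity
  have hC0 : 0 < C := by positivity
  refine ⟨C, hC0, 202, by norm_num, fun G hG p q hp hpt hpq n d μ ε η δ ν D hνP hmean hν hDP hD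
    hκ hε _ hδ0 hδ1 hnδ hdmax hη hμmax => ?_⟩
  rw [AdvTraining.vecNorm_two_sq] at hdmax hμmax
  have hq1 := AdvTraining.one_le_of_conj hpq
  obtain ⟨hn, hd, E, hE, hPE, hal⟩ := AdvTraining.exists_event_run_aligned hν hmean hD hp hpt hpq
    hε hκ0 hκ1 hκ hs hc (by linarith) (by linarith) (by linarith) (by linarith) (by linarith)
    hδ0 hδ1 hnδ ((mul_le_mul_of_nonneg_left (le_max_left _ _) hC0.le).trans hdmax)
    ((mul_le_mul_of_nonneg_left (le_max_right _ _) hC0.le).trans hdmax) hη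
    ((mul_le_mul_of_nonneg_left (le_max_left _ _) hC0.le).trans hμmax)
    ((mul_le_mul_of_nonneg_left (le_max_right _ _) hC0.le).trans hμmax)
  refine ⟨E, hE, hPE, fun S hS _ α hα0 hα θ hrun t ht => ?_⟩
  -- Both cases differ only in the factor `r` comparing `ε ‖·‖_q` with `‖·‖₂`, which is also the
  -- term subtracted in the gap.
  have key : ∀ r : ℝ, 0 ≤ r →
      (∀ v : Fin d → ℝ, ε * AdvTraining.vecNorm q v ≤ r * AdvTraining.vecNorm 2 v) →
      0 ≤ AdvTraining.gap 100 1 q ε μ n t r →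
      AdvTraining.advRisk D p ε (θ t) ≤
        η + Real.exp (-(1 / 60) * AdvTraining.gap 100 1 q ε μ n t r ^ 2) := by
    intro r hr hrq hgap
    have hg := AdvTraining.gap_add_le hq1 hε hd μ n t r
    have hd0 : (0 : ℝ) < d := by exact_mod_cast hd
    have hsq0 : 0 < Real.sqrt d := Real.sqrt_pos.2 hd0
    have hrμ : r * (100 * Real.sqrt d) ≤ μ ⬝ᵥ μ := by
      refine le_trans ?_ hg
      gcongr
      linarith
    obtain ⟨hpos, hle⟩ := hal S hS r hr hrq hrμ _ θ
      (AdvTraining.stepSize_pos hn hd (by linarith) hα0)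
      (AdvTraining.stepSize_mul_le hn hd hG (le_max_right _ _) hα) hrun t (by omega)
    have hθ0 := AdvTraining.vecNorm_nonneg 2 (by norm_num) (θ t)
    -- A vanishing `θ t` would contradict `0 < θ t ⬝ᵥ μ`.
    have hθ : 0 < AdvTraining.vecNorm 2 (θ t) := by
      refine hθ0.lt_of_ne fun h0 => ?_
      have h1 := AdvTraining.abs_dotProduct_le_two (θ t) μ
      rw [← h0, zero_mul] at h1
      linarith [le_abs_self (θ t ⬝ᵥ μ)]
    refine AdvTraining.advRisk_le hp hpt hpq hν hmean hD hgap hθ ?_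
    have h2 := mul_le_mul_of_nonneg_right hg hθ0
    have h3 : 88 * Real.sqrt d * (θ t ⬝ᵥ μ) ≤ 100 * Real.sqrt d * (θ t ⬝ᵥ μ) := by
      gcongr
      norm_num
    refine le_of_mul_le_mul_left (a := 100 * Real.sqrt d) ?_ (by positivity)
    have h4 := mul_le_mul_of_nonneg_left (hrq (θ t)) (show 0 ≤ 100 * Real.sqrt d by positivity)
    linarith
  refine ⟨fun hp2 => key ε hε fun v => ?_, fun hp2 => key _ (by positivity) fun v => ?_⟩
  · exact mul_le_mul_of_nonneg_left
      (AdvTraining.vecNorm_le_vecNorm_two (AdvTraining.two_le_conj hp2 hpq) v) hε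
  · rw [mul_assoc]
    exact mul_le_mul_of_nonneg_left (AdvTraining.vecNorm_le_rpow_mul_vecNorm_two hq1
      (AdvTraining.conj_le_two hp2.le hpq) v) hε
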